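/- Let $\ell_2$ be the real Hilbert space of square-summable sequences. A *name* of a point $x\in\ell_2$ is a sequence $(a_n)_{n\in\mathbb{N}}$ of finite sequences of rational numbers (identified with the vectors $(r_0,\dots,r_m,0,0,\dots)\in\ell_2$ and coded by natural numbers in the usual way) such that $\lVert a_n-a_m\rVert<2^{-n}$ for all $m>n$ and $a_n\to x$ in norm. A sequence $(x_i)_{i\in\mathbb{N}}$ in $\ell_2$ is *computable* if there is a computable double sequence $(a_{i,n})_{i,n}$ such that $(a_{i,n})_n$ is a name of $x_i$ for every $i$; a Turing degree $d$ *computes* a point $x$ if some name of $x$ is computable in $d$. A point $x$ is a *weak cluster point* of $(x_i)_i$ if there is a subsequence $(x_{i_k})_k$ with $\lim_{k\to\infty}\langle y,x_{i_k}\rangle=\langle y,x\rangle$ for all $y\in\ell_2$. Let $0''$ be the degree of the second Turing jump of $\emptyset$, where the jump of $A\subseteq\mathbb{N}$ is $A'=\{e \mid \{e\}^A(e)\text{ halts}\}$. For every Turing degree $d$ the following are equivalent: 1. $d\ge_T 0''$; 2. for every computable sequence $(x_i)_i$ in $\ell_2$ that is bounded in norm, $d$ computes a weak cluster point of $(x_i)_i$.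 -/

import Mathlib

open Filter Topology

/-! ### Oracle machines and the Turing jump -/

/-- Programs for partial recursive functions `ℕ →. ℕ` with an oracle: the programs of
`Nat.Partrec.Code` together with one instruction that queries the oracle. -/
inductive OracleCode : Type
  | zero : OracleCode
  | succ : OracleCode
  | left : OracleCode
  | right : OracleCode
  | oracle : OracleCode
  | pair : OracleCode → OracleCode → OracleCode
  | comp : OracleCode → OracleCode → OracleCode
  | prec : OracleCode → OracleCode → OracleCode
  | rfind' : OracleCode → OracleCode

namespace OracleCode

/-- The partial function computed by a program with oracle `g`. -/
def eval (g : ℕ → ℕ) : OracleCode → ℕ →. ℕ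
  | zero => pure 0
  | succ => fun n => Part.some (n + 1)
  | left => fun n => Part.some n.unpair.1
  | right => fun n => Part.some n.unpair.2
  | oracle => fun n => Part.some (g n)
  | pair cf cg => fun n => Nat.pair <$> eval g cf n <*> eval g cg n
  | comp cf cg => fun n => eval g cg n >>= eval g cf
  | prec cf cg =>
    Nat.unpaired fun a n =>
      n.rec (eval g cf a) fun y IH => do
        let i ← IH
        eval g cg (Nat.pair a (Nat.pair y i))
  | rfind' cf =>
    Nat.unpaired fun a m =>
      (Nat.rfind fun n => (fun k => k = 0) <$> eval g cf (Nat.pair a (n + m))).map (· + m)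

/-- The Gödel numbering of programs: `ofNat e` is the program with index `e`, and every program
has exactly one index. -/
def ofNat : ℕ → OracleCode
  | 0 => zero
  | 1 => succ
  | 2 => left
  | 3 => right
  | 4 => oracle
  | n + 5 =>
    let m := n.div2.div2
    have hm : m < n + 5 := by
      simp only [m, Nat.div2_val]
      exact lt_of_le_of_lt (le_trans (Nat.div_le_self _ _) (Nat.div_le_self _ _))
        (Nat.lt_add_of_pos_right (by decide))
    have _m1 : m.unpair.1 < n + 5 := lt_of_le_of_lt m.unpair_left_le hm
    have _m2 : m.unpair.2 < n + 5 := lt_of_le_of_lt m.unpair_right_le hm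
    match n.bodd, n.div2.bodd with
    | false, false => pair (ofNat m.unpair.1) (ofNat m.unpair.2)
    | false, true  => comp (ofNat m.unpair.1) (ofNat m.unpair.2)
    | true,  false => prec (ofNat m.unpair.1) (ofNat m.unpair.2)
    | true,  true  => rfind' (ofNat m)
termination_by e => e
decreasing_by all_goals first | exact _m1 | exact _m2 | exact hm

end OracleCode

/-- The characteristic function of a set of natural numbers. -/
noncomputable def charFun (A : Set ℕ) : ℕ → ℕ := A.indicator 1

/-- The Turing jump `A' = {e | {e}^A(e) halts}`. -/
def turingJump (A : Set ℕ) : Set ℕ :=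
  {e | ((OracleCode.ofNat e).eval (charFun A) e).Dom}

/-- The Turing degree of a (total) function on the natural numbers. Mathlib's `TuringDegree`
consists of the degrees of all partial functions; those of sets and total functions are among
them. -/
def degreeOf (f : ℕ → ℕ) : TuringDegree :=
  toAntisymmetrization TuringReducible (fun n => Part.some (f n))

/-- The degree `0''`. -/
noncomputable def zeroDoubleJump : TuringDegree :=
  degreeOf (charFun (turingJump (turingJump ∅)))

/-! ### Computability in `ℓ₂` -/

/-- The real Hilbert space `ℓ₂`. -/
abbrev Ell2 : Type := lp (fun _ : ℕ => ℝ) 2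

theorem memLp_finiteSeq (r : List ℚ) :
    Memℓp (E := fun _ : ℕ => ℝ) (fun j => ((r.getD j 0 : ℚ) : ℝ)) 2 := by
  refine (memℓp_zero ?_).of_exponent_ge zero_le
  refine (Set.finite_lt_nat r.length).subset fun j hj => ?_
  by_contra h
  have h0 : r.getD j 0 = 0 := List.getD_eq_default _ _ (not_lt.mp h)
  exact hj (by rw [h0, Rat.cast_zero])

/-- The vector `(r₀, …, rₘ, 0, 0, …)` of `ℓ₂` given by a finite sequence of rationals. These
vectors are the countable dense `ℚ`-vector space whose completion is `ℓ₂`. -/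
def finiteSeqVec (r : List ℚ) : Ell2 := ⟨fun j => ((r.getD j 0 : ℚ) : ℝ), memLp_finiteSeq r⟩

/-- The code of a finite sequence of rationals, each rational being coded by its numerator and
denominator in lowest terms. -/
def finiteSeqCode (r : List ℚ) : ℕ :=
  Encodable.encode (r.map fun q => (q.num, q.den))

/-- `a` is a name of `x`: a sequence of finite rational sequences with
`‖a n - a m‖ < 2⁻ⁿ` for all `m > n`, whose limit is `x`. -/
def IsName (a : ℕ → List ℚ) (x : Ell2) : Prop :=
  (∀ n m, n < m → ‖finiteSeqVec (a n) - finiteSeqVec (a m)‖ < (2 : ℝ)⁻¹ ^ n) ∧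
    Tendsto (fun n => finiteSeqVec (a n)) atTop (𝓝 x)

/-- The sequence `x₀, x₁, …` in `ℓ₂` is computable: names of its elements are computable,
uniformly in the index. -/
def IsComputableSeq (x : ℕ → Ell2) : Prop :=
  ∃ a : ℕ → ℕ → List ℚ, (∀ i, IsName (a i) (x i)) ∧ Computable₂ fun i n => finiteSeqCode (a i n)

/-- The degree `d` computes the point `x` of `ℓ₂`: it computes some name of `x`. -/
def DegreeComputes (d : TuringDegree) (x : Ell2) : Prop :=
  ∃ a : ℕ → List ℚ, IsName a x ∧ degreeOf (fun n => finiteSeqCode (a n)) ≤ d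

/-- The sequence `x₀, x₁, …` converges weakly to `p`. -/
def ConvergesWeakly (x : ℕ → Ell2) (p : Ell2) : Prop :=
  ∀ y : Ell2, Tendsto (fun i => inner ℝ y (x i)) atTop (𝓝 (inner ℝ y p))

/-- `p` is a weak cluster point of the sequence `x₀, x₁, …`: some subsequence converges weakly
to `p`. -/
def IsWeakClusterPoint (x : ℕ → Ell2) (p : Ell2) : Prop :=
  ∃ φ : ℕ → ℕ, StrictMono φ ∧ ConvergesWeakly (x ∘ φ) p

/-! Coding. Membership in `0''` has the form `∃ v, ∀ s, R e v s` with `R` primitive recursive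
(`exists_primrec_doubleJump_iff`): by the use principle a halting computation consults a finite part
of `0'`, and the stages of the enumeration of `0'` eventually get that part right. Let the `i`-th
vector have the entry `2⁻ᵉ` at coordinate `(e, v)` when `v` looks like the least witness for `e` at
stage `i`. At each stage there is at most one such `v` for each `e`, so the norms are bounded. Each
coordinate is eventually constant, so there is only one possible weak cluster point, and it has
`2⁻ᵉ` at `(e, v)` exactly when `v` is the true least witness. Whether such a `v` exists is then
visible in a single finite rational vector close to the point in norm
(`recursiveIn_name_of_cluster`). It matters that names converge in norm: for each `e`, one
approximation bounds all the coordinates `(e, v)` at once.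

Searching. Replace the sequence by its diagonal rational approximations. Whether the closed balls of
radius `2⁻ˢ⁻²` around finitely many rational centers share a weak cluster point is a `Π₂` question:
for every `n` there must be a later term whose first `n` coordinates nearly satisfy all the ball
conditions. Compactness shows that this suffices (`BallsMeetClusters.exists_cluster`), and `0''`
decides it (`turingReducible_doubleJump`). An admissible list of centers can always be prolonged by
a rational vector near the common cluster point (`BallsMeetClusters.exists_succ`), so a search
relative to `0''` produces an infinite sequence of centers (`Nat.RecursiveIn.exists_sequence`). Any
two of its balls meet, so the centers form a name, and a diagonal choice of terms converges weakly
to the limit (`exists_isName_isWeakClusterPoint`). -/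

/-! ### Oracle programs and the use principle -/

namespace OracleCode

open Nat.Partrec (Code)
open Encodable (encode decode)

/-- The partial function computed by a program whose oracle is a partial function. -/
def evalPart (p : ℕ → Part ℕ) : OracleCode → ℕ → Part ℕ
  | zero => fun _ => Part.some 0
  | succ => fun n => Part.some (n + 1)
  | left => fun n => Part.some n.unpair.1
  | right => fun n => Part.some n.unpair.2
  | oracle => p
  | pair cf cg => fun n => (evalPart p cf n).bind fun u => (evalPart p cg n).map (Nat.pair u)
  | comp cf cg => fun n => (evalPart p cg n).bind (evalPart p cf)
  | prec cf cg => fun m =>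
      m.unpair.2.rec (evalPart p cf m.unpair.1) fun y IH =>
        IH.bind fun i => evalPart p cg (Nat.pair m.unpair.1 (Nat.pair y i))
  | rfind' cf => fun m =>
      (Nat.rfind fun n => (evalPart p cf (Nat.pair m.unpair.1 (n + m.unpair.2))).map
        fun k => decide (k = 0)).map (· + m.unpair.2)

theorem evalPart_some (g : ℕ → ℕ) (c : OracleCode) :
    evalPart (fun n => Part.some (g n)) c = eval g c := by
  induction c with
  | zero | succ | left | right | oracle => rfl
  | pair cf cg ih₁ ih₂ =>
    funext n
    have h : eval g (pair cf cg) n =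
        Part.bind (Part.map Nat.pair (eval g cf n)) fun v => Part.map v (eval g cg n) := rfl
    rw [h, Part.bind_map, ← ih₁, ← ih₂]
    rfl
  | comp cf cg ih₁ ih₂ =>
    funext n
    change Part.bind _ _ = Part.bind (eval g cg n) (eval g cf)
    rw [← ih₁, ← ih₂]
  | prec cf cg ih₁ ih₂ =>
    funext n
    have h : eval g (prec cf cg) n =
        n.unpair.2.rec (eval g cf n.unpair.1) fun y IH => Part.bind IH fun i =>
          eval g cg (Nat.pair n.unpair.1 (Nat.pair y i)) := rfl
    rw [h, ← ih₁, ← ih₂]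
    rfl
  | rfind' cf ih =>
    funext n
    change _ = (Nat.rfind fun k => Part.map (fun k => decide (k = 0))
      (eval g cf (Nat.pair n.unpair.1 (k + n.unpair.2)))).map (· + n.unpair.2)
    rw [← ih]
    rfl

theorem mem_evalPart_pair {p : ℕ → Part ℕ} {cf cg : OracleCode} {n y : ℕ} :
    y ∈ evalPart p (pair cf cg) n ↔
      ∃ u ∈ evalPart p cf n, ∃ v ∈ evalPart p cg n, y = Nat.pair u v := by
  simp [evalPart, eq_comm]

theorem mem_evalPart_comp {p : ℕ → Part ℕ} {cf cg : OracleCode} {n y : ℕ} :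
    y ∈ evalPart p (comp cf cg) n ↔ ∃ u ∈ evalPart p cg n, y ∈ evalPart p cf u := by
  simp [evalPart]

theorem mem_evalPart_prec_zero {p : ℕ → Part ℕ} {cf cg : OracleCode} {a y : ℕ} :
    y ∈ evalPart p (prec cf cg) (Nat.pair a 0) ↔ y ∈ evalPart p cf a := by
  simp [evalPart]

theorem mem_evalPart_prec_succ {p : ℕ → Part ℕ} {cf cg : OracleCode} {a n y : ℕ} :
    y ∈ evalPart p (prec cf cg) (Nat.pair a (n + 1)) ↔
      ∃ i ∈ evalPart p (prec cf cg) (Nat.pair a n),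
        y ∈ evalPart p cg (Nat.pair a (Nat.pair n i)) := by
  simp [evalPart]

theorem mem_evalPart_rfind' {p : ℕ → Part ℕ} {cf : OracleCode} {a m y : ℕ} :
    y ∈ evalPart p (rfind' cf) (Nat.pair a m) ↔
      ∃ n, (0 ∈ evalPart p cf (Nat.pair a (n + m)) ∧
        ∀ k < n, ∃ z ∈ evalPart p cf (Nat.pair a (k + m)), z ≠ 0) ∧ y = n + m := by
  simp only [evalPart, Nat.unpair_pair, Part.mem_map_iff]
  refine exists_congr fun n => and_congr ?_ eq_comm
  refine Nat.mem_rfind.trans ?_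
  simp

/-- A larger partial oracle gives a larger partial function. -/
theorem evalPart_mono {p q : ℕ → Part ℕ} (h : ∀ n, ∀ y ∈ p n, y ∈ q n) (c : OracleCode) :
    ∀ n, ∀ y ∈ evalPart p c n, y ∈ evalPart q c n := by
  induction c with
  | zero | succ | left | right => exact fun n y hy => hy
  | oracle => exact h
  | pair cf cg ihf ihg =>
    intro n y hy
    obtain ⟨u, hu, v, hv, rfl⟩ := mem_evalPart_pair.1 hy
    exact mem_evalPart_pair.2 ⟨u, ihf _ _ hu, v, ihg _ _ hv, rfl⟩
  | comp cf cg ihf ihg =>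
    intro n y hy
    obtain ⟨u, hu, hy⟩ := mem_evalPart_comp.1 hy
    exact mem_evalPart_comp.2 ⟨u, ihg _ _ hu, ihf _ _ hy⟩
  | prec cf cg ihf ihg =>
    intro n
    rw [← Nat.pair_unpair n]
    generalize n.unpair.1 = a
    induction n.unpair.2 with
    | zero => exact fun y hy => mem_evalPart_prec_zero.2 (ihf _ _ (mem_evalPart_prec_zero.1 hy))
    | succ n ih =>
      intro y hy
      obtain ⟨i, hi, hy⟩ := mem_evalPart_prec_succ.1 hy
      exact mem_evalPart_prec_succ.2 ⟨i, ih _ hi, ihg _ _ hy⟩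
  | rfind' cf ih =>
    intro n y
    rw [← Nat.pair_unpair n, mem_evalPart_rfind', mem_evalPart_rfind']
    rintro ⟨k, ⟨h0, hk⟩, rfl⟩
    refine ⟨k, ⟨ih _ _ h0, fun j hj => ?_⟩, rfl⟩
    obtain ⟨z, hz, hz0⟩ := hk j hj
    exact ⟨z, ih _ _ hz, hz0⟩

/-- The restriction of a function to the numbers below `k`. -/
def restrict (g : ℕ → ℕ) (k : ℕ) : ℕ → Part ℕ :=
  fun n => (((List.range k).map g)[n]? : Part ℕ)

theorem mem_restrict {g : ℕ → ℕ} {k n y : ℕ} : y ∈ restrict g k n ↔ n < k ∧ g n = y := by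
  simp [restrict, List.getElem?_eq_some_iff]

theorem evalPart_restrict_mono (g : ℕ → ℕ) {k l : ℕ} (h : k ≤ l) {c : OracleCode} {n y : ℕ}
    (hy : y ∈ evalPart (restrict g k) c n) : y ∈ evalPart (restrict g l) c n :=
  evalPart_mono (fun _ _ hy => mem_restrict.2 ⟨(mem_restrict.1 hy).1.trans_le h,
    (mem_restrict.1 hy).2⟩) c n y hy

/-- The use principle: a halting computation queries the oracle only finitely often. -/
theorem exists_mem_evalPart_restrict (g : ℕ → ℕ) (c : OracleCode) :
    ∀ n, ∀ y ∈ eval g c n, ∃ k, y ∈ evalPart (restrict g k) c n := by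
  simp only [← evalPart_some]
  induction c with
  | zero | succ | left | right => exact fun n y hy => ⟨0, hy⟩
  | oracle =>
    exact fun n y hy => ⟨n + 1, mem_restrict.2 ⟨n.lt_succ_self, (Part.mem_some_iff.1 hy).symm⟩⟩
  | pair cf cg ihf ihg =>
    intro n y hy
    obtain ⟨u, hu, v, hv, rfl⟩ := mem_evalPart_pair.1 hy
    obtain ⟨k, hk⟩ := ihf _ _ hu
    obtain ⟨l, hl⟩ := ihg _ _ hv
    exact ⟨max k l, mem_evalPart_pair.2 ⟨u, evalPart_restrict_mono g (le_max_left _ _) hk, v,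
      evalPart_restrict_mono g (le_max_right _ _) hl, rfl⟩⟩
  | comp cf cg ihf ihg =>
    intro n y hy
    obtain ⟨u, hu, hy⟩ := mem_evalPart_comp.1 hy
    obtain ⟨k, hk⟩ := ihf _ _ hy
    obtain ⟨l, hl⟩ := ihg _ _ hu
    exact ⟨max k l, mem_evalPart_comp.2 ⟨u, evalPart_restrict_mono g (le_max_right _ _) hl,
      evalPart_restrict_mono g (le_max_left _ _) hk⟩⟩
  | prec cf cg ihf ihg =>
    intro n
    rw [← Nat.pair_unpair n]
    generalize n.unpair.1 = a
    induction n.unpair.2 with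
    | zero =>
      intro y hy
      obtain ⟨k, hk⟩ := ihf _ _ (mem_evalPart_prec_zero.1 hy)
      exact ⟨k, mem_evalPart_prec_zero.2 hk⟩
    | succ n ih =>
      intro y hy
      obtain ⟨i, hi, hy⟩ := mem_evalPart_prec_succ.1 hy
      obtain ⟨k, hk⟩ := ih _ hi
      obtain ⟨l, hl⟩ := ihg _ _ hy
      exact ⟨max k l, mem_evalPart_prec_succ.2 ⟨i, evalPart_restrict_mono g (le_max_left _ _) hk,
        evalPart_restrict_mono g (le_max_right _ _) hl⟩⟩
  | rfind' cf ih =>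
    intro n y
    rw [← Nat.pair_unpair n, mem_evalPart_rfind']
    rintro ⟨k, ⟨h0, hk⟩, rfl⟩
    obtain ⟨l, hl⟩ := ih _ _ h0
    -- The search inspects finitely many earlier values, so one bound on the queries serves them
    -- all.
    have hb : ∃ b, ∀ j < k,
        ∃ z ∈ evalPart (restrict g b) cf (Nat.pair n.unpair.1 (j + n.unpair.2)), z ≠ 0 := by
      clear h0 hl
      induction k with
      | zero => exact ⟨0, fun j hj => absurd hj j.not_lt_zero⟩
      | succ k ihk =>
        obtain ⟨b, hb⟩ := ihk fun j hj => hk j (hj.trans k.lt_succ_self)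
        obtain ⟨z, hz, hz0⟩ := hk k k.lt_succ_self
        obtain ⟨d, hd⟩ := ih _ _ hz
        refine ⟨max b d, fun j hj => ?_⟩
        rcases Nat.lt_succ_iff_lt_or_eq.1 hj with hj | rfl
        · obtain ⟨w, hw, hw0⟩ := hb j hj
          exact ⟨w, evalPart_restrict_mono g (le_max_left _ _) hw, hw0⟩
        · exact ⟨z, evalPart_restrict_mono g (le_max_right _ _) hd, hz0⟩
    obtain ⟨b, hb⟩ := hb
    refine ⟨max l b, mem_evalPart_rfind'.2
      ⟨k, ⟨evalPart_restrict_mono g (le_max_left _ _) hl, fun j hj => ?_⟩, rfl⟩⟩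
    obtain ⟨w, hw, hw0⟩ := hb j hj
    exact ⟨w, evalPart_restrict_mono g (le_max_right _ _) hw, hw0⟩

theorem mem_eval_iff_exists_restrict (g : ℕ → ℕ) (c : OracleCode) (n y : ℕ) :
    y ∈ eval g c n ↔ ∃ k, y ∈ evalPart (restrict g k) c n := by
  refine ⟨exists_mem_evalPart_restrict g c n y, fun ⟨k, hk⟩ => ?_⟩
  rw [← evalPart_some]
  exact evalPart_mono (fun _ _ h => Part.mem_some_iff.2 (mem_restrict.1 h).2.symm) c n y hk

/-- Looks up the entry `n` of the list coded by `s` in the argument `Nat.pair s n`. -/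
theorem exists_lookup_code : ∃ c : Code, ∀ (l : List ℕ) (n : ℕ),
    c.eval (Nat.pair (encode l) n) = (l[n]? : Part ℕ) := by
  have h : Partrec fun m : ℕ =>
      (((Denumerable.ofNat (List ℕ) m.unpair.1)[m.unpair.2]? : Option ℕ) : Part ℕ) :=
    Computable.ofOption ((Primrec.list_getElem?.comp
      ((Primrec.ofNat _).comp (Primrec.fst.comp Primrec.unpair))
      (Primrec.snd.comp Primrec.unpair)).to_comp)
  obtain ⟨c, hc⟩ := Code.exists_code.1 (Partrec.nat_iff.1 h)
  exact ⟨c, fun l n => by simp [hc]⟩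

/-- A program for list lookup. -/
noncomputable def lookupCode : Code := exists_lookup_code.choose

/-- A program that maps `((s, a), x)` to `(s, (a, x))`. -/
def assocCode : Code :=
  .pair (.comp .left .left) (.pair (.comp .right .left) .right)

/-- A program that maps `(s, (a, x))` to `((s, a), x)`. -/
def assocSymmCode : Code :=
  .pair (.pair .left (.comp .left .right)) (.comp .right .right)

theorem eval_pair (c d : Code) (n : ℕ) :
    (Code.pair c d).eval n = (c.eval n).bind fun u => (d.eval n).map (Nat.pair u) := by
  have h : (Code.pair c d).eval n =
      Part.bind (Part.map Nat.pair (c.eval n)) fun w => Part.map w (d.eval n) := rfl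
  rw [h, Part.bind_map]

theorem eval_pair_of_eq_some {c d : Code} {n u v : ℕ} (hc : c.eval n = Part.some u)
    (hd : d.eval n = Part.some v) : (Code.pair c d).eval n = Part.some (Nat.pair u v) := by
  rw [eval_pair, hc, hd, Part.bind_some, Part.map_some]

theorem eval_comp (c d : Code) (n : ℕ) : (Code.comp c d).eval n = (d.eval n).bind c.eval :=
  rfl

theorem eval_comp_of_eq_some {c d : Code} {n u : ℕ} (hd : d.eval n = Part.some u) :
    (Code.comp c d).eval n = c.eval u := by
  rw [eval_comp, hd]
  exact Part.bind_some u _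

theorem eval_left (a b : ℕ) : Code.left.eval (Nat.pair a b) = Part.some a := by
  change Part.some (Nat.pair a b).unpair.1 = _
  rw [Nat.unpair_pair]

theorem eval_right (a b : ℕ) : Code.right.eval (Nat.pair a b) = Part.some b := by
  change Part.some (Nat.pair a b).unpair.2 = _
  rw [Nat.unpair_pair]

theorem eval_assocCode (s a x : ℕ) :
    assocCode.eval (Nat.pair (Nat.pair s a) x) = Part.some (Nat.pair s (Nat.pair a x)) := by
  have h := eval_left (Nat.pair s a) x
  exact eval_pair_of_eq_some ((eval_comp_of_eq_some h).trans (eval_left _ _))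
    (eval_pair_of_eq_some ((eval_comp_of_eq_some h).trans (eval_right _ _)) (eval_right _ _))

theorem eval_assocSymmCode (s a x : ℕ) :
    assocSymmCode.eval (Nat.pair s (Nat.pair a x)) = Part.some (Nat.pair (Nat.pair s a) x) := by
  have h := eval_right s (Nat.pair a x)
  exact eval_pair_of_eq_some (eval_pair_of_eq_some (eval_left _ _)
    ((eval_comp_of_eq_some h).trans (eval_left _ _)))
    ((eval_comp_of_eq_some h).trans (eval_right _ _))

/-- The program that, on the argument `Nat.pair (encode l) n`, runs a given oracle program on `n`
with the finite oracle `l`. -/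
noncomputable def relativize : OracleCode → Code
  | zero => .zero
  | succ => .comp .succ .right
  | left => .comp .left .right
  | right => .comp .right .right
  | oracle => lookupCode
  | pair cf cg => .pair (relativize cf) (relativize cg)
  | comp cf cg => .comp (relativize cf) (.pair .left (relativize cg))
  | prec cf cg => .comp (.prec (relativize cf) (.comp (relativize cg) assocCode)) assocSymmCode
  | rfind' cf => .comp (.rfind' (.comp (relativize cf) assocCode)) assocSymmCode

/-- The list code travels along as the left component of every argument. Recursion and search keep
the left component of their argument fixed, so there the list must be grouped with the parameter;
`assocSymmCode` does this and `assocCode` undoes it inside the loop. -/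
theorem eval_relativize (l : List ℕ) (c : OracleCode) : ∀ n,
    (relativize c).eval (Nat.pair (encode l) n) = evalPart (fun n => (l[n]? : Part ℕ)) c n := by
  induction c with
  | zero => intro n; rfl
  | succ | left | right => exact fun n => eval_comp_of_eq_some (eval_right _ _)
  | oracle => exact exists_lookup_code.choose_spec l
  | pair cf cg ihf ihg =>
    intro n
    rw [relativize, eval_pair, ihf, ihg]
    rfl
  | comp cf cg ihf ihg =>
    intro n
    rw [relativize, eval_comp, eval_pair, eval_left, Part.bind_some, ihg]
    refine (Part.bind_map _ _ _).trans ?_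
    exact congrArg _ (funext ihf)
  | prec cf cg ihf ihg =>
    intro n
    rw [← Nat.pair_unpair n]
    generalize n.unpair.1 = a
    refine (eval_comp_of_eq_some (eval_assocSymmCode _ _ _)).trans ?_
    induction n.unpair.2 with
    | zero =>
      rw [Code.eval_prec_zero, ihf]
      simp only [evalPart, Nat.unpair_pair]
      rfl
    | succ n ih =>
      rw [Code.eval_prec_succ, ih]
      simp only [evalPart, Nat.unpair_pair, Part.bind_eq_bind]
      congr 1
      funext i
      exact (eval_comp_of_eq_some (eval_assocCode _ _ _)).trans (ihg _)
  | rfind' cf ih =>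
    intro n
    rw [← Nat.pair_unpair n]
    refine (eval_comp_of_eq_some (eval_assocSymmCode _ _ _)).trans ?_
    change Part.map _ (Nat.rfind fun k => Part.map _ _) = Part.map _ (Nat.rfind fun k => Part.map _ _)
    simp only [Nat.unpair_pair]
    congr 2
    funext k
    congr 1
    exact (eval_comp_of_eq_some (eval_assocCode _ _ _)).trans (ih _)

end OracleCode

/-! ### The double jump as a `Σ₂` set -/

theorem PrimrecRel.exists_lt_comp {α : Type*} [Primcodable α] {R : ℕ → α → Prop} {f : α → ℕ}
    (hR : PrimrecRel R) (hf : Primrec f) : PrimrecPred fun a => ∃ x < f a, R x a :=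
  (hR.exists_mem_list.comp (Primrec.list_range.comp hf) Primrec.id).of_eq (by simp)

theorem PrimrecRel.forall_lt_comp {α : Type*} [Primcodable α] {R : ℕ → α → Prop} {f : α → ℕ}
    (hR : PrimrecRel R) (hf : Primrec f) : PrimrecPred fun a => ∀ x < f a, R x a :=
  (hR.forall_mem_list.comp (Primrec.list_range.comp hf) Primrec.id).of_eq (by simp)

namespace OracleCode

open Nat.Partrec (Code)
open Encodable (encode decode)

theorem div2_div2_lt (n : ℕ) : n.div2.div2 < n + 5 := by
  simp only [Nat.div2_val]
  omega

theorem ofNat_add_five (n : ℕ) : ofNat (n + 5) =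
    cond n.bodd
      (cond n.div2.bodd (rfind' (ofNat n.div2.div2))
        (prec (ofNat n.div2.div2.unpair.1) (ofNat n.div2.div2.unpair.2)))
      (cond n.div2.bodd (comp (ofNat n.div2.div2.unpair.1) (ofNat n.div2.div2.unpair.2))
        (pair (ofNat n.div2.div2.unpair.1) (ofNat n.div2.div2.unpair.2))) := by
  rw [ofNat]
  cases n.bodd <;> cases n.div2.bodd <;> rfl

/-- Translating the program with a given index is primitive recursive. -/
theorem primrec_relativize_ofNat : Primrec fun e => relativize (ofNat e) := by
  open Primrec in
  -- `IH` holds the translations of all indices below `n + 5`. All three lookups are made in every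
  -- case; this is harmless, since all three indices are in range.
  let step : List Code → ℕ → Option Code := fun IH n =>
    IH[n.div2.div2]?.bind fun s =>
    IH[n.div2.div2.unpair.1]?.bind fun s₁ =>
    IH[n.div2.div2.unpair.2]?.map fun s₂ =>
    cond n.bodd
      (cond n.div2.bodd (.comp (.rfind' (.comp s assocCode)) assocSymmCode)
        (.comp (.prec s₁ (.comp s₂ assocCode)) assocSymmCode))
      (cond n.div2.bodd (.comp s₁ (.pair .left s₂)) (.pair s₁ s₂))
  have hstep : Primrec₂ step := by
    have hm : Primrec fun p : List Code × ℕ => p.2.div2.div2 := nat_div2.comp (nat_div2.comp snd)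
    refine option_bind (list_getElem?.comp fst hm) <| .mk <|
      option_bind ((list_getElem?.comp fst (fst.comp (Primrec.unpair.comp hm))).comp fst) <| .mk <|
      option_map ((list_getElem?.comp fst (snd.comp (Primrec.unpair.comp hm))).comp
        (fst.comp fst)) <| .mk ?_
    have n : Primrec fun p : (((List Code × ℕ) × Code) × Code) × Code => p.1.1.1.2 :=
      snd.comp (fst.comp (fst.comp fst))
    have s : Primrec fun p : (((List Code × ℕ) × Code) × Code) × Code => p.1.1.2 :=
      snd.comp (fst.comp fst)
    have s₁ : Primrec fun p : (((List Code × ℕ) × Code) × Code) × Code => p.1.2 :=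
      snd.comp fst
    have s₂ : Primrec fun p : (((List Code × ℕ) × Code) × Code) × Code => p.2 := snd
    refine (nat_bodd.comp n).cond
      ((nat_bodd.comp <| nat_div2.comp n).cond
        (Code.primrec₂_comp.comp
          (Code.primrec_rfind'.comp (Code.primrec₂_comp.comp s (const _))) (const _))
        (Code.primrec₂_comp.comp
          (Code.primrec₂_prec.comp s₁ (Code.primrec₂_comp.comp s₂ (const _))) (const _)))
      ((nat_bodd.comp <| nat_div2.comp n).cond
        (Code.primrec₂_comp.comp s₁ (Code.primrec₂_pair.comp (const _) s₂))
        (Code.primrec₂_pair.comp s₁ s₂))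
  let G : List Code → Option Code := fun IH =>
    IH.length.casesOn (some (relativize (ofNat 0))) fun n =>
    n.casesOn (some (relativize (ofNat 1))) fun n =>
    n.casesOn (some (relativize (ofNat 2))) fun n =>
    n.casesOn (some (relativize (ofNat 3))) fun n =>
    n.casesOn (some (relativize (ofNat 4))) fun n => step IH n
  have hG : Primrec G :=
    nat_casesOn list_length (const _) <| .mk <|
    nat_casesOn snd (const _) <| .mk <|
    nat_casesOn snd (const _) <| .mk <|
    nat_casesOn snd (const _) <| .mk <|
    nat_casesOn snd (const _) <| .mk <|
    hstep.comp (fst.comp (fst.comp (fst.comp (fst.comp fst)))) snd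
  have := nat_strong_rec (fun (_ : Unit) e => relativize (ofNat e))
    (g := fun _ IH => G IH) (hG.comp snd).to₂ fun _ n => ?_
  · exact this.comp (const ()) .id
  iterate 5 rcases n with - | n; · simp only [G, List.length_map, List.length_range]; rfl
  simp only [G, List.length_map, List.length_range, step]
  have hm := div2_div2_lt n
  have h1 := (n.div2.div2.unpair_left_le).trans_lt hm
  have h2 := (n.div2.div2.unpair_right_le).trans_lt hm
  simp only [List.getElem?_map, List.getElem?_range hm, List.getElem?_range h1,
    List.getElem?_range h2, Option.map_some, Option.bind_some, ofNat_add_five]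
  cases n.bodd <;> cases n.div2.bodd <;> rfl

/-- The index of a program. -/
def toNat : OracleCode → ℕ
  | zero => 0
  | succ => 1
  | left => 2
  | right => 3
  | oracle => 4
  | pair cf cg => 2 * (2 * Nat.pair (toNat cf) (toNat cg)) + 5
  | comp cf cg => 2 * (2 * Nat.pair (toNat cf) (toNat cg) + 1) + 5
  | prec cf cg => (2 * (2 * Nat.pair (toNat cf) (toNat cg)) + 1) + 5
  | rfind' cf => (2 * (2 * toNat cf + 1) + 1) + 5

theorem ofNat_toNat (c : OracleCode) : ofNat (toNat c) = c := by
  induction c with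
  | zero | succ | left | right | oracle => simp [toNat, ofNat]
  | _ => simp [toNat, ofNat_add_five, Nat.div2_val, *]

/-- Whether the program with index `e` halts on `e` within `t` steps, with the finite oracle `l`. -/
noncomputable def haltsIn (t e : ℕ) (l : List ℕ) : Bool :=
  (Code.evaln t (relativize (ofNat e)) (Nat.pair (encode l) e)).isSome

theorem primrec_haltsIn : Primrec fun p : ℕ × ℕ × List ℕ => haltsIn p.1 p.2.1 p.2.2 := by
  open Primrec in
  exact option_isSome.comp (Code.primrec_evaln.comp
    ((fst.pair (primrec_relativize_ofNat.comp (fst.comp snd))).pair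
      (Primrec₂.natPair.comp (Primrec.encode.comp (snd.comp snd)) (fst.comp snd))))

theorem haltsIn_mono {s t e : ℕ} {l : List ℕ} (h : s ≤ t) (hs : haltsIn s e l) :
    haltsIn t e l := by
  obtain ⟨x, hx⟩ := Option.isSome_iff_exists.1 hs
  exact Option.isSome_iff_exists.2 ⟨x, Code.evaln_mono h hx⟩

theorem exists_haltsIn_iff (e : ℕ) (g : ℕ → ℕ) (k : ℕ) :
    (∃ t, haltsIn t e ((List.range k).map g)) ↔
      ∃ y, y ∈ evalPart (restrict g k) (ofNat e) e := by
  have h : ∀ y, y ∈ evalPart (restrict g k) (ofNat e) e ↔ ∃ t, y ∈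
      Code.evaln t (relativize (ofNat e)) (Nat.pair (encode ((List.range k).map g)) e) := by
    intro y
    rw [← Code.evaln_complete, eval_relativize]
    rfl
  simp only [h, haltsIn, Option.isSome_iff_exists]
  exact exists_comm

end OracleCode

section

open OracleCode

theorem mem_turingJump_iff_exists_haltsIn (A : Set ℕ) (e : ℕ) :
    e ∈ turingJump A ↔ ∃ k t, haltsIn t e ((List.range k).map (charFun A)) := by
  simp only [exists_haltsIn_iff]
  rw [exists_comm]
  simp only [← mem_eval_iff_exists_restrict]
  exact Part.dom_iff_mem

/-- The finite stages of the enumeration of the jump of the empty set. -/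
def jumpStage (s e : ℕ) : Prop :=
  ∃ k < s, haltsIn s e ((List.range k).map fun _ => 0)

open Classical in
/-- The characteristic function of a finite stage of the enumeration of the jump of the empty
set. -/
noncomputable def jumpStageFun (s e : ℕ) : ℕ := if jumpStage s e then 1 else 0

theorem primrec_jumpStageFun : Primrec₂ jumpStageFun := by
  open Primrec in
  have h : PrimrecRel fun (k : ℕ) (p : ℕ × ℕ) =>
      haltsIn p.1 p.2 ((List.range k).map fun _ => 0) = true :=
    Primrec.eq.comp (primrec_haltsIn.comp ((fst.comp snd).pair ((snd.comp snd).pair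
      (list_map (list_range.comp fst) (const 0).to₂)))) (const true)
  have h' := h.exists_lt_comp fst
  classical
  exact ite (c := fun p : ℕ × ℕ => jumpStage p.1 p.2) h' (const 1) (const 0)

theorem jumpStage_mono {s t e : ℕ} (h : s ≤ t) : jumpStage s e → jumpStage t e :=
  fun ⟨k, hk, hs⟩ => ⟨k, hk.trans_le h, haltsIn_mono h hs⟩

/-- Initial segments of the empty oracle are lists of zeros, and one number can bound both the
length of the segment and the running time. -/
theorem mem_jump_empty_iff (e : ℕ) : e ∈ turingJump ∅ ↔ ∃ s, jumpStage s e := by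
  have h0 : charFun ∅ = fun _ => 0 := funext fun n => by simp [charFun]
  rw [mem_turingJump_iff_exists_haltsIn, h0]
  constructor
  · rintro ⟨k, t, h⟩
    exact ⟨max (k + 1) t, k, (k.lt_succ_self).trans_le (le_max_left _ _),
      haltsIn_mono (le_max_right _ _) h⟩
  · rintro ⟨s, k, -, h⟩
    exact ⟨k, s, h⟩

theorem eventually_jumpStageFun_eq (e : ℕ) :
    ∀ᶠ s in atTop, jumpStageFun s e = charFun (turingJump ∅) e := by
  by_cases he : e ∈ turingJump ∅
  · obtain ⟨s, hs⟩ := (mem_jump_empty_iff e).1 he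
    filter_upwards [eventually_ge_atTop s] with t ht
    simp [jumpStageFun, jumpStage_mono ht hs, charFun, he]
  · refine Eventually.of_forall fun s => ?_
    have : ¬ jumpStage s e := fun h => he ((mem_jump_empty_iff e).2 ⟨s, h⟩)
    simp [jumpStageFun, this, charFun, he]

/-- The limit lemma for `0'`: a finite part of the oracle is correct from some stage on. -/
theorem eventually_map_jumpStageFun_eq (k : ℕ) :
    ∀ᶠ s in atTop, (List.range k).map (jumpStageFun s) =
      (List.range k).map (charFun (turingJump ∅)) := by
  have h : ∀ᶠ s in atTop, ∀ e ∈ Set.Iio k, jumpStageFun s e = charFun (turingJump ∅) e :=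
    (Filter.eventually_all_finite (Set.finite_Iio k)).2 fun e _ => eventually_jumpStageFun_eq e
  filter_upwards [h] with s hs
  exact List.map_congr_left fun e he => hs e (List.mem_range.1 he)

/-- The double jump of the empty set is a `Σ₂` set. -/
theorem exists_primrec_doubleJump_iff : ∃ R : ℕ → ℕ → ℕ → Prop,
    PrimrecPred (fun p : (ℕ × ℕ) × ℕ => R p.1.1 p.1.2 p.2) ∧
      ∀ e, e ∈ turingJump (turingJump ∅) ↔ ∃ v, ∀ s, R e v s := by
  -- The witness `v` codes `(k, (t, s₀))`: the use, the running time, and a stage from which the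
  -- approximation to `0'` below `k` is claimed to be stable. Stages before `s₀` impose nothing.
  refine ⟨fun e v s => s < v.unpair.2.unpair.2 ∨
    haltsIn v.unpair.2.unpair.1 e ((List.range v.unpair.1).map (jumpStageFun s)) = true, ?_, ?_⟩
  · open Primrec in
    have v : Primrec fun p : (ℕ × ℕ) × ℕ => p.1.2.unpair := Primrec.unpair.comp (snd.comp fst)
    have w : Primrec fun p : (ℕ × ℕ) × ℕ => p.1.2.unpair.2.unpair :=
      Primrec.unpair.comp (snd.comp v)
    exact (nat_lt.comp snd (snd.comp w)).or (Primrec.eq.comp (primrec_haltsIn.comp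
      ((fst.comp w).pair ((fst.comp fst).pair (list_map (list_range.comp (fst.comp v))
        (primrec_jumpStageFun.comp (snd.comp fst) snd).to₂)))) (const true))
  · intro e
    rw [mem_turingJump_iff_exists_haltsIn]
    constructor
    · rintro ⟨k, t, h⟩
      obtain ⟨s₀, hs⟩ := eventually_atTop.1 (eventually_map_jumpStageFun_eq k)
      refine ⟨Nat.pair k (Nat.pair t s₀), fun s => ?_⟩
      simp only [Nat.unpair_pair]
      rcases lt_or_ge s s₀ with h' | h'
      · exact .inl h'
      · exact .inr (by rw [hs s h', h])
    · rintro ⟨v, hv⟩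
      obtain ⟨s₀, hs⟩ := eventually_atTop.1 (eventually_map_jumpStageFun_eq v.unpair.1)
      refine ⟨v.unpair.1, v.unpair.2.unpair.1, ?_⟩
      rw [← hs _ (le_max_left s₀ v.unpair.2.unpair.2)]
      exact (hv _).resolve_left (le_max_right _ _).not_gt

end

/-! ### `Π₂` sets are recursive in the double jump -/

namespace OracleCode

open Encodable (encode decode)

theorem eval_pair_some {g : ℕ → ℕ} {cf cg : OracleCode} {n u v : ℕ}
    (hf : eval g cf n = Part.some u) (hg : eval g cg n = Part.some v) :
    eval g (pair cf cg) n = Part.some (Nat.pair u v) := by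
  rw [← evalPart_some] at *
  simp only [evalPart, hf, hg, Part.bind_some, Part.map_some]

theorem eval_comp_some {g : ℕ → ℕ} {cf cg : OracleCode} {n u : ℕ}
    (hg : eval g cg n = Part.some u) : eval g (comp cf cg) n = eval g cf u := by
  have h : eval g (comp cf cg) n = (eval g cg n).bind (eval g cf) := rfl
  rw [h, hg]
  exact Part.bind_some u _

/-- Every partial function that is recursive in `g` is computed by a program with oracle `g`. -/
theorem exists_eval_eq {g : ℕ → ℕ} {f : ℕ →. ℕ}
    (hf : Nat.RecursiveIn {fun n => Part.some (g n)} f) : ∃ c : OracleCode, eval g c = f := by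
  induction hf with
  | zero => exact ⟨zero, rfl⟩
  | succ => exact ⟨succ, rfl⟩
  | left => exact ⟨left, rfl⟩
  | right => exact ⟨right, rfl⟩
  | oracle h hh => exact ⟨oracle, (Set.mem_singleton_iff.1 hh).symm⟩
  | pair _ _ ihf ihg =>
    obtain ⟨cf, rfl⟩ := ihf
    obtain ⟨cg, rfl⟩ := ihg
    exact ⟨pair cf cg, rfl⟩
  | comp _ _ ihf ihg =>
    obtain ⟨cf, rfl⟩ := ihf
    obtain ⟨cg, rfl⟩ := ihg
    exact ⟨comp cf cg, rfl⟩
  | prec _ _ ihf ihg =>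
    obtain ⟨cf, rfl⟩ := ihf
    obtain ⟨cg, rfl⟩ := ihg
    exact ⟨prec cf cg, rfl⟩
  | rfind _ ih =>
    obtain ⟨c, rfl⟩ := ih
    -- `rfind'` searches upwards from the second component, so unbounded search is `rfind'` started
    -- at `0`; `pair left right` is the identity.
    refine ⟨comp (rfind' c) (pair (pair left right) zero), funext fun n => ?_⟩
    have hn : eval g (pair (pair left right) zero) n = Part.some (Nat.pair n 0) := by
      have h := eval_pair_some (g := g) (cf := left) (cg := right) (n := n) rfl rfl
      rw [Nat.pair_unpair] at h
      exact eval_pair_some h rfl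
    rw [eval_comp_some hn, ← evalPart_some]
    simp only [evalPart, Nat.unpair_pair, add_zero]
    refine (Part.map_id' (fun _ => rfl) _).trans ?_
    rw [evalPart_some]
    rfl

/-- A program for a constant function. -/
def const : ℕ → OracleCode
  | 0 => zero
  | n + 1 => comp succ (const n)

theorem eval_const (g : ℕ → ℕ) (w n : ℕ) : eval g (const w) n = Part.some w := by
  induction w with
  | zero => rfl
  | succ w ih => rw [const, eval_comp_some ih]; rfl

theorem primrec_toNat_const : Primrec fun w => toNat (const w) := by
  open Primrec in
  have h : Primrec₂ fun (_ : ℕ) (y : ℕ) => 2 * (2 * Nat.pair 1 y + 1) + 5 :=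
    nat_add.comp (nat_double.comp (nat_double_succ.comp
      (Primrec₂.natPair.comp (Primrec.const 1) snd))) (Primrec.const 5)
  refine (nat_rec₁ 0 h).of_eq fun w => ?_
  induction w with
  | zero => rfl
  | succ w ih => simp only [ih, const, toNat]

end OracleCode

section

open OracleCode

/-- The domain of a partial function recursive in `A` is many-one reducible to the jump of `A`. -/
theorem exists_primrec_mem_turingJump_iff {A : Set ℕ} {f : ℕ →. ℕ}
    (hf : Nat.RecursiveIn {fun n => Part.some (charFun A n)} f) :
    ∃ h : ℕ → ℕ, Primrec h ∧ ∀ w, h w ∈ turingJump A ↔ (f w).Dom := by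
  obtain ⟨c, rfl⟩ := exists_eval_eq hf
  -- This program ignores its input and runs `c` on `w`, so the self-application in the jump does no
  -- harm.
  refine ⟨fun w => toNat (comp c (const w)), ?_, fun w => ?_⟩
  · open Primrec in
    exact nat_add.comp (nat_double.comp (nat_double_succ.comp
      (Primrec₂.natPair.comp (Primrec.const (toNat c)) primrec_toNat_const))) (Primrec.const 5)
  · rw [turingJump, Set.mem_ofPred_eq, ofNat_toNat, eval_comp_some (eval_const _ _ _)]

theorem charFun_eq_zero_iff {A : Set ℕ} {n : ℕ} : charFun A n = 0 ↔ n ∉ A := by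
  simp [charFun]

theorem Nat.RecursiveIn.comp_some {O : Set (ℕ →. ℕ)} {f h : ℕ → ℕ}
    (hf : Nat.RecursiveIn O fun n => Part.some (f n))
    (hh : Nat.RecursiveIn O fun n => Part.some (h n)) :
    Nat.RecursiveIn O fun n => Part.some (f (h n)) :=
  (hf.comp hh).of_eq fun n => Part.bind_some (h n) fun n => Part.some (f n)

theorem Nat.RecursiveIn.pair_some {O : Set (ℕ →. ℕ)} {f h : ℕ → ℕ}
    (hf : Nat.RecursiveIn O fun n => Part.some (f n))
    (hh : Nat.RecursiveIn O fun n => Part.some (h n)) :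
    Nat.RecursiveIn O fun n => Part.some (Nat.pair (f n) (h n)) :=
  (hf.pair hh).of_eq fun n => by simp [Seq.seq]

theorem Computable.natRecursiveIn {O : Set (ℕ →. ℕ)} {f : ℕ → ℕ} (hf : Computable f) :
    Nat.RecursiveIn O fun n => Part.some (f n) :=
  (Partrec.nat_iff.1 hf).recursiveIn

theorem Nat.RecursiveIn.rfind_dom_iff {f : ℕ → ℕ} {w : ℕ} :
    (Nat.rfind fun n => (fun m => decide (m = 0)) <$> Part.some (f (Nat.pair w n))).Dom ↔
      ∃ n, f (Nat.pair w n) = 0 := by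
  refine Nat.rfind_dom.trans ?_
  constructor
  · rintro ⟨n, hn, -⟩
    exact ⟨n, by simpa using hn⟩
  · intro ⟨n, hn⟩
    exact ⟨n, by simpa using hn, fun _ => trivial⟩

/-- Every `Π₂` set is recursive in the double jump of the empty set. -/
theorem turingReducible_doubleJump {R : ℕ → ℕ → ℕ → Prop}
    (hR : ComputablePred fun p : (ℕ × ℕ) × ℕ => R p.1.1 p.1.2 p.2) :
    Nat.RecursiveIn {fun n => Part.some (charFun (turingJump (turingJump ∅)) n)}
      fun w => Part.some (charFun {w | ∀ n, ∃ i, R w n i} w) := by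
  classical
  have hR' : Computable fun m : ℕ =>
      if R m.unpair.1.unpair.1 m.unpair.1.unpair.2 m.unpair.2 then 0 else 1 := by
    have h₁ : Computable fun m : ℕ => ((m.unpair.1.unpair.1, m.unpair.1.unpair.2), m.unpair.2) :=
      (Computable.unpair.comp (Computable.fst.comp Computable.unpair)).pair
        (Computable.snd.comp Computable.unpair)
    refine ((hR.decide.comp h₁).cond (Computable.const 0) (Computable.const 1)).of_eq fun m => ?_
    by_cases h : R m.unpair.1.unpair.1 m.unpair.1.unpair.2 m.unpair.2 <;> simp [h]
  -- The search for `i` reduces `∃ i, R w n i` to `0'`. A second search, relative to `0'`, looks for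
  -- an `n` where this fails; its halting is decided by `0''`, and `1 - n` below negates the answer.
  obtain ⟨h₁, h₁p, h₁s⟩ := exists_primrec_mem_turingJump_iff (A := ∅) hR'.natRecursiveIn.rfind
  have h₂ : Nat.RecursiveIn {fun n => Part.some (charFun (turingJump ∅) n)}
      fun m => Part.some (charFun (turingJump ∅) (h₁ m)) :=
    (Nat.RecursiveIn.oracle _ (Set.mem_singleton _)).comp_some h₁p.to_comp.natRecursiveIn
  obtain ⟨h₃, h₃p, h₃s⟩ := exists_primrec_mem_turingJump_iff h₂.rfind
  have h₄ : Computable fun n => 1 - n := (Primrec.nat_sub.comp (Primrec.const 1) .id).to_comp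
  refine (h₄.natRecursiveIn.comp_some ((Nat.RecursiveIn.oracle _ (Set.mem_singleton _)).comp_some
    h₃p.to_comp.natRecursiveIn)).of_eq fun w => ?_
  congr 1
  have key : h₃ w ∈ turingJump (turingJump ∅) ↔ ¬ ∀ n, ∃ i, R w n i := by
    rw [h₃s, Nat.RecursiveIn.rfind_dom_iff (f := fun m => charFun (turingJump ∅) (h₁ m))]
    simp only [charFun_eq_zero_iff, h₁s]
    rw [not_forall]
    refine exists_congr fun n => not_congr ?_
    rw [Nat.RecursiveIn.rfind_dom_iff (f := fun m : ℕ =>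
      if R m.unpair.1.unpair.1 m.unpair.1.unpair.2 m.unpair.2 then 0 else 1)]
    simp
  by_cases h : ∀ n, ∃ i, R w n i
  · rw [charFun_eq_zero_iff.2 (fun h' => key.1 h' h)]
    simp [charFun, h]
  · have hmem := key.2 h
    simp [charFun, h, hmem]

end

/-! ### Weak convergence and codes in `ℓ₂` -/

theorem sum_sq_le_norm_sq (f : Ell2) (s : Finset ℕ) : ∑ j ∈ s, f j ^ 2 ≤ ‖f‖ ^ 2 := by
  have h := lp.sum_rpow_le_norm_rpow (p := 2) (by norm_num) f s
  simpa using h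

theorem norm_le_of_sum_sq_le {f : Ell2} {C : ℝ} (hC : 0 ≤ C)
    (h : ∀ n, ∑ j ∈ Finset.range n, f j ^ 2 ≤ C ^ 2) : ‖f‖ ≤ C := by
  refine lp.norm_le_of_forall_sum_le (p := 2) (by norm_num) hC fun s => ?_
  obtain ⟨n, hn⟩ := s.exists_nat_subset_range
  have := (Finset.sum_le_sum_of_subset_of_nonneg hn fun j _ _ => sq_nonneg (f j)).trans (h n)
  simpa using this

theorem abs_apply_le_norm (f : Ell2) (j : ℕ) : |f j| ≤ ‖f‖ :=
  lp.norm_apply_le_norm (by norm_num) f j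

/-- A bounded sequence that converges coordinatewise converges weakly. -/
theorem convergesWeakly_of_tendsto_apply {x : ℕ → Ell2} {p : Ell2} {C : ℝ}
    (hC : ∀ i, ‖x i‖ ≤ C) (h : ∀ j, Tendsto (fun i => x i j) atTop (𝓝 (p j))) :
    ConvergesWeakly x p := by
  intro y
  have hC0 : 0 ≤ C := (norm_nonneg _).trans (hC 0)
  rw [Metric.tendsto_atTop]
  intro ε hε
  -- Truncate `y` to finitely many coordinates. Since `‖x i - p‖ ≤ C + ‖p‖`, this tolerance costs at
  -- most `ε / 2`; the `+ 1` keeps the denominator positive.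
  obtain ⟨s, hs⟩ := ((lp.hasSum_single (E := fun _ : ℕ => ℝ) (p := 2) (by norm_num) y).eventually
    (Metric.ball_mem_nhds y (show 0 < ε / (2 * (C + ‖p‖ + 1)) by positivity))).exists
  set z : Ell2 := ∑ j ∈ s, lp.single 2 j (y j) with hz
  have hlim : Tendsto (fun i => inner ℝ z (x i)) atTop (𝓝 (inner ℝ z p)) := by
    simp only [hz, sum_inner, lp.inner_single_left]
    exact tendsto_finsetSum _ fun j _ => tendsto_const_nhds.inner (h j)
  obtain ⟨N, hN⟩ := Metric.tendsto_atTop.1 hlim (ε / 2) (by positivity)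
  refine ⟨N, fun i hi => ?_⟩
  have h1 : inner ℝ y (x i) - inner ℝ y p =
      inner ℝ (y - z) (x i - p) + (inner ℝ z (x i) - inner ℝ z p) := by
    simp only [inner_sub_left, inner_sub_right]; ring
  have h2 : |inner ℝ (y - z) (x i - p)| ≤ ε / 2 := by
    have hyz : ‖y - z‖ ≤ ε / (2 * (C + ‖p‖ + 1)) := by
      rw [← dist_eq_norm, dist_comm]; exact (Metric.mem_ball.1 hs).le
    calc |inner ℝ (y - z) (x i - p)| ≤ ‖y - z‖ * ‖x i - p‖ := abs_real_inner_le_norm _ _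
      _ ≤ ε / (2 * (C + ‖p‖ + 1)) * (C + ‖p‖ + 1) := by
        gcongr
        exact (norm_sub_le _ _).trans (by linarith [hC i])
      _ = ε / 2 := by
        have : C + ‖p‖ + 1 ≠ 0 := by positivity
        field_simp
  rw [Real.dist_eq, h1]
  have h3 := hN i hi
  rw [Real.dist_eq] at h3
  exact (abs_add_le _ _).trans_lt (by linarith)

theorem ConvergesWeakly.tendsto_apply {x : ℕ → Ell2} {p : Ell2} (h : ConvergesWeakly x p) (j : ℕ) :
    Tendsto (fun i => x i j) atTop (𝓝 (p j)) := by
  simpa [lp.inner_single_left] using h (lp.single 2 j (1 : ℝ))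

@[simp]
theorem finiteSeqVec_apply (r : List ℚ) (j : ℕ) : finiteSeqVec r j = ((r.getD j 0 : ℚ) : ℝ) :=
  rfl

theorem IsName.norm_sub_le {a : ℕ → List ℚ} {p : Ell2} (h : IsName a p) (n : ℕ) :
    ‖finiteSeqVec (a n) - p‖ ≤ (2 : ℝ)⁻¹ ^ n :=
  le_of_tendsto (tendsto_const_nhds.sub h.2).norm
    ((eventually_gt_atTop n).mono fun m hm => (h.1 n m hm).le)

/-! ### Primitive recursive access to integers and coded sequences. -/

theorem encode_int_ofNat (n : ℕ) : Encodable.encode (Int.ofNat n) = 2 * n :=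
  rfl

theorem encode_int_negSucc (n : ℕ) : Encodable.encode (Int.negSucc n) = 2 * n + 1 :=
  rfl

/-- Integers are coded by `n ↦ 2n` and `-(n + 1) ↦ 2n + 1`, so the absolute value is half the
successor of the code, rounded down, and the parity gives the sign. -/
theorem primrec_int_natAbs : Primrec Int.natAbs := by
  refine (Primrec.nat_div.comp (Primrec.succ.comp Primrec.encode) (Primrec.const 2)).of_eq ?_
  rintro (n | n)
  · rw [encode_int_ofNat]
    change (2 * n + 1) / 2 = n
    omega
  · rw [encode_int_negSucc]
    change (2 * n + 1 + 1) / 2 = n + 1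
    omega

theorem primrec_int_toNat : Primrec Int.toNat := by
  refine (Primrec.cond (Primrec.nat_bodd.comp Primrec.encode) (Primrec.const 0)
    (Primrec.nat_div2.comp Primrec.encode)).of_eq ?_
  rintro (n | n)
  · rw [encode_int_ofNat]
    simp
  · rw [encode_int_negSucc]
    simp

/-- Decoding of finite sequences of pairs `(numerator, denominator)`. -/
def decodeSeq (c : ℕ) : List (ℤ × ℕ) :=
  (Encodable.decode c).getD []

theorem primrec_decodeSeq : Primrec decodeSeq :=
  Primrec.option_getD.comp Primrec.decode (Primrec.const [])

theorem decodeSeq_encode (l : List (ℤ × ℕ)) : decodeSeq (Encodable.encode l) = l := by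
  simp [decodeSeq]

theorem decodeSeq_finiteSeqCode (r : List ℚ) :
    decodeSeq (finiteSeqCode r) = r.map fun q => (q.num, q.den) :=
  decodeSeq_encode _

/-! ### Coding the double jump into weak cluster points -/

theorem primrec_pow : Primrec₂ ((· ^ ·) : ℕ → ℕ → ℕ) := Primrec₂.unpaired'.1 Nat.Primrec.pow

/-- `v` is the least witness of `∀ s, R e v s`, as far as the numbers `s < i` can tell. -/
def LeastWitnessBelow (R : ℕ → ℕ → ℕ → Prop) (e v i : ℕ) : Prop :=
  (∀ s < i, R e v s) ∧ ∀ u < v, ¬ ∀ s < i, R e u s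

/-- `v` is the least witness of `∀ s, R e v s`. -/
def LeastWitness (R : ℕ → ℕ → ℕ → Prop) (e v : ℕ) : Prop :=
  (∀ s, R e v s) ∧ ∀ u < v, ¬ ∀ s, R e u s

theorem exists_leastWitness_iff {R : ℕ → ℕ → ℕ → Prop} {e : ℕ} :
    (∃ v, LeastWitness R e v) ↔ ∃ v, ∀ s, R e v s := by
  classical
  exact ⟨fun ⟨v, hv⟩ => ⟨v, hv.1⟩, fun h => ⟨Nat.find h, Nat.find_spec h, fun u => Nat.find_min h⟩⟩

theorem LeastWitnessBelow.unique {R : ℕ → ℕ → ℕ → Prop} {e v w i : ℕ}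
    (hv : LeastWitnessBelow R e v i) (hw : LeastWitnessBelow R e w i) : v = w :=
  le_antisymm (not_lt.1 fun h => hv.2 w h hw.1) (not_lt.1 fun h => hw.2 v h hv.1)

theorem eventually_forall_lt_iff {P : ℕ → Prop} :
    ∀ᶠ i in atTop, ((∀ s < i, P s) ↔ ∀ s, P s) := by
  by_cases h : ∀ s, P s
  · exact Eventually.of_forall fun i => ⟨fun _ => h, fun _ s _ => h s⟩
  · obtain ⟨s, hs⟩ := not_forall.1 h
    filter_upwards [eventually_gt_atTop s] with i hi
    exact ⟨fun h' => absurd (h' s hi) hs, fun h' s _ => h' s⟩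

/-- Only the finitely many `u ≤ v` matter, and each false universal statement is refuted from some
stage on. -/
theorem eventually_leastWitnessBelow_iff (R : ℕ → ℕ → ℕ → Prop) (e v : ℕ) :
    ∀ᶠ i in atTop, (LeastWitnessBelow R e v i ↔ LeastWitness R e v) := by
  have h : ∀ᶠ i in atTop, ∀ u ∈ Set.Iio v, ((∀ s < i, R e u s) ↔ ∀ s, R e u s) :=
    (Filter.eventually_all_finite (Set.finite_Iio v)).2 fun u _ => eventually_forall_lt_iff
  filter_upwards [h, eventually_forall_lt_iff (P := R e v)] with i hi hv
  exact and_congr hv (forall₂_congr fun u hu => not_congr (hi u hu))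

theorem primrecPred_leastWitnessBelow {R : ℕ → ℕ → ℕ → Prop}
    (hR : PrimrecPred fun p : (ℕ × ℕ) × ℕ => R p.1.1 p.1.2 p.2) :
    PrimrecPred fun p : (ℕ × ℕ) × ℕ => LeastWitnessBelow R p.1.1 p.1.2 p.2 := by
  open Primrec in
  have h₁ : PrimrecPred fun p : (ℕ × ℕ) × ℕ => ∀ s < p.2, R p.1.1 p.1.2 s :=
    PrimrecRel.forall_lt_comp (R := fun s (p : (ℕ × ℕ) × ℕ) => R p.1.1 p.1.2 s)
      (hR.comp ((fst.comp snd).pair fst)) snd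
  exact h₁.and (PrimrecRel.forall_lt_comp
    (R := fun u (p : (ℕ × ℕ) × ℕ) => ¬ ∀ s < p.2, R p.1.1 u s)
    (h₁.comp (((fst.comp (fst.comp snd)).pair fst).pair (snd.comp snd))).not (snd.comp fst))

open Classical in
/-- The coordinate `j = (e, v)` of the `i`-th vector of the coding sequence: it is `2⁻ᵉ` if `v`
is at stage `i` the least witness for `e`, and `0` otherwise. -/
noncomputable def codingCoord (R : ℕ → ℕ → ℕ → Prop) (i j : ℕ) : ℚ :=
  if LeastWitnessBelow R j.unpair.1 j.unpair.2 i then ((2 ^ j.unpair.1 : ℕ) : ℚ)⁻¹ else 0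

/-- The coding sequence of a `Σ₂` set. -/
noncomputable def codingSeq (R : ℕ → ℕ → ℕ → Prop) (i : ℕ) : List ℚ :=
  (List.range i).map (codingCoord R i)

theorem codingSeq_getD (R : ℕ → ℕ → ℕ → Prop) {i j : ℕ} (h : j < i) :
    (codingSeq R i).getD j 0 = codingCoord R i j := by
  simp [codingSeq, List.getD, h]

theorem codingSeq_getD_of_le (R : ℕ → ℕ → ℕ → Prop) {i j : ℕ} (h : i ≤ j) :
    (codingSeq R i).getD j 0 = 0 :=
  List.getD_eq_default _ _ (by simpa [codingSeq] using h)

theorem primrec_codingSeq_code {R : ℕ → ℕ → ℕ → Prop}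
    (hR : PrimrecPred fun p : (ℕ × ℕ) × ℕ => R p.1.1 p.1.2 p.2) :
    Primrec fun i => finiteSeqCode (codingSeq R i) := by
  classical
  open Primrec in
  have hj : Primrec fun p : ℕ × ℕ => p.2.unpair := Primrec.unpair.comp snd
  have hentry : Primrec₂ fun i j : ℕ => if LeastWitnessBelow R j.unpair.1 j.unpair.2 i then
      ((1 : ℤ), 2 ^ j.unpair.1) else ((0 : ℤ), 1) :=
    ite ((primrecPred_leastWitnessBelow hR).comp (hj.pair fst))
      ((const 1).pair (primrec_pow.comp (const 2) (fst.comp hj))) (const (0, 1))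
  refine (Primrec.encode.comp (list_map list_range hentry)).of_eq fun i => ?_
  simp only [finiteSeqCode, codingSeq, List.map_map]
  congr 2
  funext j
  simp only [Function.comp, codingCoord]
  split_ifs
  · rw [Rat.inv_natCast_num_of_pos (by positivity), Rat.inv_natCast_den_of_pos (by positivity)]
  · rfl

/-- By `LeastWitnessBelow.unique` each `e` contributes at most one nonzero coordinate, so the sum is
at most `∑ 4⁻ᵉ = 4 / 3`. -/
theorem codingSeq_sq_le (R : ℕ → ℕ → ℕ → Prop) (i n : ℕ) :
    ∑ j ∈ Finset.range n, finiteSeqVec (codingSeq R i) j ^ 2 ≤ 2 ^ 2 := by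
  classical
  let S := (Finset.range n).filter fun j => LeastWitnessBelow R j.unpair.1 j.unpair.2 i
  have h1 : ∀ j ∈ Finset.range n, finiteSeqVec (codingSeq R i) j ^ 2 ≤
      if LeastWitnessBelow R j.unpair.1 j.unpair.2 i then (1 / 4 : ℝ) ^ j.unpair.1 else 0 := by
    intro j _
    rw [finiteSeqVec_apply]
    rcases lt_or_ge j i with hj | hj
    · rw [codingSeq_getD R hj, codingCoord]
      split_ifs
      · push_cast
        rw [← inv_pow, ← pow_mul, mul_comm, pow_mul]
        norm_num
      · simp
    · rw [codingSeq_getD_of_le R hj]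
      split_ifs
      · simp
      · simp
  have hinj : Set.InjOn (fun j : ℕ => j.unpair.1) (S : Set ℕ) := by
    intro j hj k hk hjk
    have hj' := (Finset.mem_filter.1 hj).2
    have hk' := (Finset.mem_filter.1 hk).2
    simp only at hjk
    rw [hjk] at hj'
    rw [← Nat.pair_unpair j, ← Nat.pair_unpair k, hjk, hj'.unique hk']
  calc ∑ j ∈ Finset.range n, finiteSeqVec (codingSeq R i) j ^ 2
      ≤ ∑ j ∈ S, (1 / 4 : ℝ) ^ j.unpair.1 :=
        (Finset.sum_le_sum h1).trans_eq (Finset.sum_filter _ _).symm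
    _ = ∑ e ∈ S.image fun j : ℕ => j.unpair.1, (1 / 4 : ℝ) ^ e := (Finset.sum_image hinj).symm
    _ ≤ ∑' e : ℕ, (1 / 4 : ℝ) ^ e :=
        (summable_geometric_of_lt_one (by norm_num) (by norm_num)).sum_le_tsum _
          fun e _ => by positivity
    _ ≤ 2 ^ 2 := by
        rw [tsum_geometric_of_lt_one (by norm_num) (by norm_num)]
        norm_num

open Classical in
theorem tendsto_codingSeq (R : ℕ → ℕ → ℕ → Prop) (j : ℕ) :
    Tendsto (fun i => finiteSeqVec (codingSeq R i) j) atTop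
      (𝓝 (if LeastWitness R j.unpair.1 j.unpair.2 then (2 : ℝ)⁻¹ ^ j.unpair.1 else 0)) := by
  refine tendsto_const_nhds.congr' ?_
  filter_upwards [eventually_gt_atTop j,
    eventually_leastWitnessBelow_iff R j.unpair.1 j.unpair.2] with i hi h
  rw [finiteSeqVec_apply, codingSeq_getD R hi, codingCoord]
  simp only [h]
  split_ifs <;> simp

theorem isName_const (r : List ℚ) : IsName (fun _ => r) (finiteSeqVec r) :=
  ⟨fun n m _ => by rw [sub_self, norm_zero]; positivity, tendsto_const_nhds⟩

theorem isComputableSeq_codingSeq {R : ℕ → ℕ → ℕ → Prop}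
    (hR : PrimrecPred fun p : (ℕ × ℕ) × ℕ => R p.1.1 p.1.2 p.2) :
    IsComputableSeq fun i => finiteSeqVec (codingSeq R i) :=
  ⟨fun i _ => codingSeq R i, fun _ => isName_const _,
    ((primrec_codingSeq_code hR).comp Primrec.fst).to_comp⟩

/-- Some coordinate `(e, v)` of the coded finite sequence is larger than `2⁻ᵉ / 2`. -/
def HasLargeCoord (e c : ℕ) : Prop :=
  ∃ j < (decodeSeq c).length, j.unpair.1 = e ∧
    ((decodeSeq c).getD j (0, 1)).2 < ((decodeSeq c).getD j (0, 1)).1.natAbs * 2 ^ (e + 1)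

theorem primrecRel_hasLargeCoord : PrimrecRel HasLargeCoord := by
  open Primrec in
  have hl : Primrec fun p : ℕ × ℕ => decodeSeq p.2 := primrec_decodeSeq.comp snd
  have hq : Primrec fun p : ℕ × ℕ × ℕ => (decodeSeq p.2.2).getD p.1 (0, 1) :=
    (list_getD (0, 1)).comp (hl.comp snd) fst
  exact PrimrecRel.exists_lt_comp (R := fun j (p : ℕ × ℕ) => j.unpair.1 = p.1 ∧
    ((decodeSeq p.2).getD j (0, 1)).2 <
      ((decodeSeq p.2).getD j (0, 1)).1.natAbs * 2 ^ (p.1 + 1))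
    ((Primrec.eq.comp (fst.comp (Primrec.unpair.comp fst)) (fst.comp snd)).and
      (nat_lt.comp (snd.comp hq) (nat_mul.comp (primrec_int_natAbs.comp (fst.comp hq))
        (primrec_pow.comp (const 2) (succ.comp (fst.comp snd)))))) (list_length.comp hl)

theorem lt_abs_rat_iff (q : ℚ) (e : ℕ) :
    q.den < q.num.natAbs * 2 ^ (e + 1) ↔ (2 : ℝ)⁻¹ ^ (e + 1) < |(q : ℝ)| := by
  have hd : (0 : ℝ) < q.den := by exact_mod_cast q.den_pos
  have hq : |(q : ℝ)| = (q.num.natAbs : ℝ) / q.den := by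
    conv_lhs => rw [← Rat.num_div_den q]
    push_cast
    rw [abs_div, abs_of_pos hd, Nat.cast_natAbs, Int.cast_abs]
  rw [hq, lt_div_iff₀ hd, inv_pow, inv_mul_lt_iff₀ (by positivity), mul_comm]
  exact_mod_cast Iff.rfl

/-- The search over `v` is bounded by the length of the list: beyond it the entries are `0` and
cannot exceed the positive threshold. -/
theorem hasLargeCoord_finiteSeqCode_iff (e : ℕ) (r : List ℚ) :
    HasLargeCoord e (finiteSeqCode r) ↔
      ∃ v, (2 : ℝ)⁻¹ ^ (e + 1) < |finiteSeqVec r (Nat.pair e v)| := by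
  have hget : ∀ j, (r.map fun q => (q.num, q.den)).getD j ((0 : ℤ), 1) =
      ((r.getD j 0).num, (r.getD j 0).den) := fun j =>
    List.getD_map r 0 fun q : ℚ => (q.num, q.den)
  simp only [HasLargeCoord, decodeSeq_finiteSeqCode, hget, List.length_map, lt_abs_rat_iff,
    finiteSeqVec_apply]
  constructor
  · rintro ⟨j, -, rfl, h⟩
    exact ⟨j.unpair.2, by rwa [Nat.pair_unpair]⟩
  · rintro ⟨v, h⟩
    refine ⟨Nat.pair e v, not_le.1 fun hle => ?_, by rw [Nat.unpair_pair], h⟩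
    rw [List.getD_eq_default _ _ hle, Rat.cast_zero, abs_zero] at h
    exact h.not_ge (by positivity)

/-- Every name of a weak cluster point of the coding sequence computes the coded set. -/
theorem recursiveIn_name_of_cluster {R : ℕ → ℕ → ℕ → Prop} {p : Ell2}
    (hp : IsWeakClusterPoint (fun i => finiteSeqVec (codingSeq R i)) p) {a : ℕ → List ℚ}
    (ha : IsName a p) {A : Set ℕ} (hA : ∀ e, e ∈ A ↔ ∃ v, ∀ s, R e v s) :
    Nat.RecursiveIn {fun n => Part.some (finiteSeqCode (a n))} fun n => Part.some (charFun A n) := by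
  classical
  obtain ⟨φ, hφ, hw⟩ := hp
  have hcoord : ∀ j, p j =
      if LeastWitness R j.unpair.1 j.unpair.2 then (2 : ℝ)⁻¹ ^ j.unpair.1 else 0 := fun j =>
    tendsto_nhds_unique (hw.tendsto_apply j) ((tendsto_codingSeq R j).comp hφ.tendsto_atTop)
  -- The coordinate of `p` is `2⁻ᵉ` or `0` and the error is at most a quarter of `2⁻ᵉ`, so the
  -- threshold `2⁻ᵉ / 2` separates the cases.
  have key : ∀ e, HasLargeCoord e (finiteSeqCode (a (e + 2))) ↔ e ∈ A := by
    intro e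
    rw [hasLargeCoord_finiteSeqCode_iff, hA, ← exists_leastWitness_iff]
    refine exists_congr fun v => ?_
    have hpv := hcoord (Nat.pair e v)
    have hdist : |finiteSeqVec (a (e + 2)) (Nat.pair e v) - p (Nat.pair e v)| ≤
        (2 : ℝ)⁻¹ ^ (e + 2) :=
      (abs_apply_le_norm (finiteSeqVec (a (e + 2)) - p) _).trans (ha.norm_sub_le _)
    have hpos : (0 : ℝ) < 2⁻¹ ^ e := by positivity
    rw [Nat.unpair_pair] at hpv
    rw [pow_succ, pow_succ] at hdist
    rw [pow_succ]
    by_cases hl : LeastWitness R e v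
    · simp only [hl, if_true, iff_true] at hpv ⊢
      rw [hpv] at hdist
      refine lt_of_lt_of_le ?_ (le_abs_self _)
      linarith [(abs_le.1 hdist).1]
    · simp only [hl, if_false, iff_false, not_lt] at hpv ⊢
      rw [hpv, sub_zero] at hdist
      linarith
  have hH : Computable fun m : ℕ => if HasLargeCoord m.unpair.1 m.unpair.2 then 1 else 0 :=
    (Primrec.ite (primrecRel_hasLargeCoord.comp (Primrec.fst.comp Primrec.unpair)
      (Primrec.snd.comp Primrec.unpair)) (Primrec.const 1) (Primrec.const 0)).to_comp
  have hadd : Computable fun e => e + 2 := (Primrec.nat_add.comp .id (Primrec.const 2)).to_comp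
  refine (hH.natRecursiveIn.comp_some ((Computable.id.natRecursiveIn).pair_some
    ((Nat.RecursiveIn.oracle _ (Set.mem_singleton _)).comp_some hadd.natRecursiveIn))).of_eq
    fun e => ?_
  simp [key, charFun, Set.indicator_apply]

theorem degreeOf_le_iff {f g : ℕ → ℕ} : degreeOf f ≤ degreeOf g ↔
    Nat.RecursiveIn {fun n => Part.some (g n)} fun n => Part.some (f n) :=
  RecursiveIn.iff_nat

theorem zeroDoubleJump_le_of_forall_cluster {d : TuringDegree}
    (h : ∀ x : ℕ → Ell2, IsComputableSeq x → (∃ C : ℝ, ∀ i, ‖x i‖ ≤ C) →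
      ∃ p : Ell2, IsWeakClusterPoint x p ∧ DegreeComputes d p) : zeroDoubleJump ≤ d := by
  obtain ⟨R, hR, hmem⟩ := exists_primrec_doubleJump_iff
  obtain ⟨p, hp, a, ha, had⟩ := h _ (isComputableSeq_codingSeq hR)
    ⟨2, fun i => norm_le_of_sum_sq_le zero_le_two (codingSeq_sq_le R i)⟩
  exact (degreeOf_le_iff.2 (recursiveIn_name_of_cluster hp ha hmem)).trans had

/-! ### Nested balls and weak cluster points -/

/-- The first `m` closed balls with centers `r s` and radii `2⁻ˢ⁻²` have a common weak cluster
point of the sequence `b`, expressed by finite sums of squares. -/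
def BallsMeetClusters (b r : ℕ → Ell2) (m : ℕ) : Prop :=
  ∀ n, ∃ i, n < i ∧ ∀ s < m,
    ∑ j ∈ Finset.range n, (b i j - r s j) ^ 2 < (1 / 4 : ℝ) ^ (s + 2) + (1 / 2 : ℝ) ^ n

theorem tendsto_sum_sq_sub {θ : ℕ → ℕ} {b : ℕ → Ell2} {p : Ell2}
    (h : ∀ j, Tendsto (fun k => b (θ k) j) atTop (𝓝 (p j))) (q : Ell2) (n : ℕ) :
    Tendsto (fun k => ∑ j ∈ Finset.range n, (b (θ k) j - q j) ^ 2) atTop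
      (𝓝 (∑ j ∈ Finset.range n, (p j - q j) ^ 2)) :=
  tendsto_finsetSum _ fun j _ => ((h j).sub_const _).pow 2

theorem tendsto_half_pow : Tendsto (fun n : ℕ => (1 / 2 : ℝ) ^ n) atTop (𝓝 0) :=
  tendsto_pow_atTop_nhds_zero_of_lt_one (by norm_num) (by norm_num)

/-- Choose one index `θ n > n` for each `n`. The chosen vectors lie in a compact product of
intervals, so a subsequence converges coordinatewise; boundedness puts the limit in `ℓ₂`, and the
ball conditions pass to it because the slack `2⁻ⁿ` vanishes. -/
theorem BallsMeetClusters.exists_cluster {b r : ℕ → Ell2} {m : ℕ} {C : ℝ}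
    (hC : ∀ i, ‖b i‖ ≤ C) (h : BallsMeetClusters b r m) :
    ∃ (p : Ell2) (θ : ℕ → ℕ), Tendsto θ atTop atTop ∧
      (∀ j, Tendsto (fun k => b (θ k) j) atTop (𝓝 (p j))) ∧
      ∀ s < m, ‖p - r s‖ ≤ (1 / 2 : ℝ) ^ (s + 2) := by
  choose θ hθ hs using h
  have hK : IsCompact (Set.univ.pi fun _ : ℕ => Set.Icc (-C) C) :=
    isCompact_univ_pi fun _ => isCompact_Icc
  obtain ⟨f, -, ψ, hψ, hf⟩ := hK.tendsto_subseq (x := fun n => (b (θ n) : ℕ → ℝ)) fun n j _ =>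
    abs_le.1 ((abs_apply_le_norm _ j).trans (hC _))
  have hmem : Memℓp (E := fun _ : ℕ => ℝ) f 2 := by
    refine lp.memℓp_of_tendsto (F := fun k => b (θ (ψ k))) (l := atTop) ?_ hf
    exact isBounded_iff_forall_norm_le.2 ⟨C, Set.forall_mem_range.2 fun k => hC _⟩
  have hcoord : ∀ j, Tendsto (fun k => b (θ (ψ k)) j) atTop (𝓝 (f j)) := fun j =>
    (tendsto_pi_nhds.1 hf) j
  refine ⟨⟨f, hmem⟩, θ ∘ ψ, ?_, hcoord, fun s hsm => ?_⟩
  · exact (tendsto_atTop_mono (fun n => (hθ n).le) tendsto_id).comp hψ.tendsto_atTop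
  · refine norm_le_of_sum_sq_le (by positivity) fun n => ?_
    have h1 : Tendsto (fun k => (1 / 4 : ℝ) ^ (s + 2) + (1 / 2 : ℝ) ^ ψ k) atTop
        (𝓝 ((1 / 4 : ℝ) ^ (s + 2) + 0)) :=
      (tendsto_half_pow.comp hψ.tendsto_atTop).const_add _
    have h2 := le_of_tendsto_of_tendsto
      (tendsto_sum_sq_sub (p := ⟨f, hmem⟩) (θ := θ ∘ ψ) hcoord (r s) n) h1
      ((eventually_ge_atTop n).mono fun k hk => ?_)
    · rw [← pow_mul, mul_comm, pow_mul]
      norm_num at h2 ⊢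
      exact h2
    -- The condition at `ψ k ≥ n` covers at least the first `n` coordinates.
    · refine le_trans ?_ (hs (ψ k) s hsm).le
      exact Finset.sum_le_sum_of_subset_of_nonneg
        (Finset.range_subset_range.2 (hk.trans (hψ.id_le k))) fun _ _ _ => sq_nonneg _

/-- The vector with the single coordinate `c` at `j`. -/
def singleVec (j : ℕ) (c : ℝ) : Ell2 := lp.single 2 j c

theorem singleVec_apply (j : ℕ) (c : ℝ) (k : ℕ) : singleVec j c k = if k = j then c else 0 := by
  rw [singleVec, lp.coeFn_single, Pi.single_apply]

theorem norm_singleVec (j : ℕ) (c : ℝ) : ‖singleVec j c‖ = |c| :=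
  lp.norm_single (E := fun _ : ℕ => ℝ) (by norm_num) j c

theorem sum_singleVec_apply (n : ℕ) (c : ℕ → ℝ) (k : ℕ) :
    (∑ j ∈ Finset.range n, singleVec j (c j)) k = if k < n then c k else 0 := by
  rw [lp.coeFn_sum, Finset.sum_apply]
  simp only [singleVec_apply, Finset.sum_ite_eq, Finset.mem_range]

theorem exists_norm_sub_finiteSeqVec_lt (p : Ell2) {ε : ℝ} (hε : 0 < ε) :
    ∃ r : List ℚ, ‖p - finiteSeqVec r‖ < ε := by
  have hsum : Tendsto (fun n => ∑ j ∈ Finset.range n, singleVec j (p j)) atTop (𝓝 p) :=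
    (lp.hasSum_single (E := fun _ : ℕ => ℝ) (p := 2) (by norm_num) p).tendsto_sum_nat
  obtain ⟨n, hn⟩ := (hsum.eventually (Metric.ball_mem_nhds p (half_pos hε))).exists
  -- Rounding `n` coordinates with this error costs at most `ε / 2` in norm; truncation costs the
  -- other half.
  choose t ht using fun j => exists_rat_btwn
    (show p j - ε / (2 * (n + 1)) < p j from sub_lt_self _ (by positivity))
  have hr : ∑ j ∈ Finset.range n, singleVec j (p j) - finiteSeqVec ((List.range n).map t) =
      ∑ j ∈ Finset.range n, singleVec j (p j - t j) := by
    ext k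
    rw [lp.coeFn_sub, Pi.sub_apply, sum_singleVec_apply, sum_singleVec_apply n fun j => p j - t j,
      finiteSeqVec_apply]
    by_cases hk : k < n <;> simp [List.getD, hk]
  have h1 : ‖∑ j ∈ Finset.range n, singleVec j (p j - t j)‖ ≤ ε / 2 := by
    calc ‖∑ j ∈ Finset.range n, singleVec j (p j - t j)‖
        ≤ ∑ j ∈ Finset.range n, ‖singleVec j (p j - t j)‖ := norm_sum_le _ _
      _ ≤ ∑ _j ∈ Finset.range n, ε / (2 * (n + 1)) := by
          refine Finset.sum_le_sum fun j _ => ?_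
          rw [norm_singleVec, abs_le]
          constructor <;> linarith [(ht j).1, (ht j).2]
      _ ≤ ε / 2 := by
          rw [Finset.sum_const, Finset.card_range, nsmul_eq_mul]
          have : (n : ℝ) * (ε / (2 * (n + 1))) = ε / 2 * (n / (n + 1)) := by field_simp
          rw [this]
          refine mul_le_of_le_one_right (by positivity) ?_
          rw [div_le_one (by positivity)]
          linarith
  have h2 : ‖p - ∑ j ∈ Finset.range n, singleVec j (p j)‖ < ε / 2 := by
    rw [← dist_eq_norm, dist_comm]; exact hn
  refine ⟨(List.range n).map t, ?_⟩
  rw [← sub_add_sub_cancel p (∑ j ∈ Finset.range n, singleVec j (p j)), hr]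
  exact (norm_add_le _ _).trans_lt (by linarith)

theorem quarter_pow_eq (s : ℕ) : (1 / 4 : ℝ) ^ s = ((1 / 2 : ℝ) ^ s) ^ 2 := by
  rw [← pow_mul, mul_comm, pow_mul]
  norm_num

theorem BallsMeetClusters.zero (b r : ℕ → Ell2) : BallsMeetClusters b r 0 :=
  fun n => ⟨n + 1, n.lt_succ_self, fun s hs => absurd hs s.not_lt_zero⟩

/-- A rational vector within `2⁻ᵐ⁻²` of a common cluster point is a suitable new center: the same
cluster point lies in all `m + 1` balls. The positive slack turns this into strict inequalities that
hold along the subsequence. Any `r'` with the right first `m + 1` values is allowed, so that the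
lemma applies to the entries of a prolonged list. -/
theorem BallsMeetClusters.exists_succ {b r : ℕ → Ell2} {m : ℕ} {C : ℝ}
    (hC : ∀ i, ‖b i‖ ≤ C) (h : BallsMeetClusters b r m) :
    ∃ q : List ℚ, ∀ r' : ℕ → Ell2, (∀ s < m, r' s = r s) → r' m = finiteSeqVec q →
      BallsMeetClusters b r' (m + 1) := by
  obtain ⟨p, θ, hθ, hcoord, hp⟩ := h.exists_cluster hC
  obtain ⟨q, hq⟩ := exists_norm_sub_finiteSeqVec_lt p
    (show (0 : ℝ) < (1 / 2) ^ (m + 2) by positivity)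
  refine ⟨q, fun r' hr' hm n => ?_⟩
  have hball : ∀ s < m + 1, ‖p - r' s‖ ≤ (1 / 2 : ℝ) ^ (s + 2) := by
    intro s hs
    rcases Nat.lt_succ_iff_lt_or_eq.1 hs with hs | rfl
    · rw [hr' s hs]; exact hp s hs
    · rw [hm]; exact hq.le
  have hev : ∀ᶠ k in atTop, ∀ s ∈ Set.Iio (m + 1),
      ∑ j ∈ Finset.range n, (b (θ k) j - r' s j) ^ 2 <
        (1 / 4 : ℝ) ^ (s + 2) + (1 / 2 : ℝ) ^ n := by
    refine (Filter.eventually_all_finite (Set.finite_Iio _)).2 fun s hs => ?_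
    refine (tendsto_sum_sq_sub hcoord (r' s) n).eventually_lt_const ?_
    calc ∑ j ∈ Finset.range n, (p j - r' s j) ^ 2 ≤ ‖p - r' s‖ ^ 2 :=
          sum_sq_le_norm_sq (p - r' s) _
      _ ≤ ((1 / 2 : ℝ) ^ (s + 2)) ^ 2 := by gcongr; exact hball s hs
      _ = (1 / 4 : ℝ) ^ (s + 2) := (quarter_pow_eq _).symm
      _ < _ := lt_add_of_pos_right _ (by positivity)
  obtain ⟨k, hk, hk'⟩ := (hev.and (hθ.eventually_gt_atTop n)).exists
  exact ⟨θ k, hk', hk⟩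

/-- Both balls contain a common point, and `2⁻ˢ⁻² + 2⁻ᵗ⁻² ≤ 2⁻ˢ⁻¹ < 2⁻ˢ`. This is why the radii are
`2⁻ˢ⁻²`. -/
theorem norm_sub_lt_of_forall_ballsMeetClusters {b r : ℕ → Ell2} {C : ℝ} (hC : ∀ i, ‖b i‖ ≤ C)
    (h : ∀ m, BallsMeetClusters b r m) {s t : ℕ} (hst : s < t) :
    ‖r s - r t‖ < (2 : ℝ)⁻¹ ^ s := by
  obtain ⟨p, -, -, -, hp⟩ := (h (t + 1)).exists_cluster hC
  have h1 := hp s (hst.trans t.lt_succ_self)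
  have h2 := hp t t.lt_succ_self
  have h3 : (1 / 2 : ℝ) ^ (t + 2) ≤ (1 / 2 : ℝ) ^ (s + 2) :=
    pow_le_pow_of_le_one (by norm_num) (by norm_num) (by omega)
  have h4 : ‖r s - r t‖ ≤ ‖p - r s‖ + ‖p - r t‖ := by
    have : r s - r t = (p - r t) - (p - r s) := by abel
    rw [this, add_comm]
    exact norm_sub_le _ _
  have h5 : (0 : ℝ) < (1 / 2) ^ s := by positivity
  rw [← one_div]
  rw [pow_add (1 / 2 : ℝ) s] at h3 h1
  linarith

/-- The cluster points of the finite families may vary with `m`, so none of them is used. Instead,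
the `m`-th chosen term is close to `r m` on the first `m` coordinates, with an error that tends to
`0`, while `r m` tends to `p`. -/
theorem exists_subseq_of_forall_ballsMeetClusters {b r : ℕ → Ell2} {p : Ell2}
    (h : ∀ m, BallsMeetClusters b r m) (hp : Tendsto r atTop (𝓝 p)) :
    ∃ φ : ℕ → ℕ, StrictMono φ ∧ ∀ j, Tendsto (fun k => b (φ k) j) atTop (𝓝 (p j)) := by
  have hfreq : ∀ m, ∃ᶠ i in atTop, ∑ j ∈ Finset.range m, (b i j - r m j) ^ 2 <
      (1 / 4 : ℝ) ^ (m + 2) + (1 / 2 : ℝ) ^ m := by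
    intro m
    refine frequently_atTop.2 fun n => ?_
    obtain ⟨i, hi, hs⟩ := h (m + 1) (max n m)
    refine ⟨i, (le_max_left _ _).trans hi.le, ?_⟩
    calc ∑ j ∈ Finset.range m, (b i j - r m j) ^ 2
        ≤ ∑ j ∈ Finset.range (max n m), (b i j - r m j) ^ 2 :=
          Finset.sum_le_sum_of_subset_of_nonneg
            (Finset.range_subset_range.2 (le_max_right _ _)) fun _ _ _ => sq_nonneg _
      _ < (1 / 4 : ℝ) ^ (m + 2) + (1 / 2 : ℝ) ^ max n m := hs m m.lt_succ_self
      _ ≤ _ := by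
          have := pow_le_pow_of_le_one (show (0 : ℝ) ≤ 1 / 2 by norm_num) (by norm_num)
            (le_max_right n m)
          linarith
  obtain ⟨φ, hφ, hs⟩ := extraction_forall_of_frequently hfreq
  refine ⟨φ, hφ, fun j => ?_⟩
  have hbound : Tendsto (fun m : ℕ => (1 / 4 : ℝ) ^ (m + 2) + (1 / 2 : ℝ) ^ m) atTop (𝓝 0) := by
    have h4 : Tendsto (fun m : ℕ => (1 / 4 : ℝ) ^ (m + 2)) atTop (𝓝 0) :=
      (tendsto_pow_atTop_nhds_zero_of_lt_one (by norm_num) (by norm_num)).comp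
        (tendsto_add_atTop_nat 2)
    simpa using h4.add tendsto_half_pow
  have hsq : Tendsto (fun m => (b (φ m) j - r m j) ^ 2) atTop (𝓝 0) := by
    refine squeeze_zero' (Eventually.of_forall fun m => sq_nonneg _) ?_ hbound
    filter_upwards [eventually_gt_atTop j] with m hm
    exact (Finset.single_le_sum (f := fun j => (b (φ m) j - r m j) ^ 2) (fun _ _ => sq_nonneg _)
      (Finset.mem_range.2 hm)).trans (hs m).le
  have hdiff : Tendsto (fun m => b (φ m) j - r m j) atTop (𝓝 0) := by
    refine (tendsto_zero_iff_abs_tendsto_zero _).2 ?_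
    have := (Real.continuous_sqrt.tendsto 0).comp hsq
    simpa [Function.comp_def, Real.sqrt_sq_eq_abs] using this
  have hrj : Tendsto (fun m => r m j) atTop (𝓝 (p j)) := by
    refine tendsto_iff_norm_sub_tendsto_zero.2 (squeeze_zero (fun _ => norm_nonneg _)
      (fun m => abs_apply_le_norm (r m - p) j) (tendsto_iff_norm_sub_tendsto_zero.1 hp))
  simpa using hdiff.add hrj

theorem norm_finiteSeqVec_diagonal_le {x : ℕ → Ell2} {a : ℕ → ℕ → List ℚ}
    {C : ℝ} (hC : ∀ i, ‖x i‖ ≤ C) (ha : ∀ i, IsName (a i) (x i)) (i : ℕ) :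
    ‖finiteSeqVec (a i i)‖ ≤ C + 1 := by
  have h1 := (ha i).norm_sub_le i
  have h2 : ((2 : ℝ)⁻¹) ^ i ≤ 1 := pow_le_one₀ (by norm_num) (by norm_num)
  have h3 := norm_le_norm_add_norm_sub' (finiteSeqVec (a i i)) (x i)
  linarith [hC i]

/-- If arbitrarily long finite families of the balls around `r s` meet the weak cluster points of
a bounded sequence, then the centers converge to a weak cluster point. -/
theorem exists_isName_isWeakClusterPoint {x : ℕ → Ell2} {a : ℕ → ℕ → List ℚ} {r : ℕ → List ℚ}
    {C : ℝ} (hC : ∀ i, ‖x i‖ ≤ C) (ha : ∀ i, IsName (a i) (x i))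
    (h : ∀ m, BallsMeetClusters (fun i => finiteSeqVec (a i i)) (fun s => finiteSeqVec (r s)) m) :
    ∃ p, IsName r p ∧ IsWeakClusterPoint x p := by
  have hb := norm_finiteSeqVec_diagonal_le hC ha
  have hlt : ∀ s t, s < t → ‖finiteSeqVec (r s) - finiteSeqVec (r t)‖ < (2 : ℝ)⁻¹ ^ s :=
    fun s t => norm_sub_lt_of_forall_ballsMeetClusters hb h
  have hcauchy : CauchySeq fun s => finiteSeqVec (r s) := by
    refine cauchySeq_of_le_geometric (2 : ℝ)⁻¹ 1 (by norm_num) fun s => ?_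
    rw [dist_eq_norm, one_mul]
    exact (hlt s (s + 1) s.lt_succ_self).le
  obtain ⟨p, hp⟩ := cauchySeq_tendsto_of_complete hcauchy
  refine ⟨p, ⟨hlt, hp⟩, ?_⟩
  obtain ⟨φ, hφ, hcoord⟩ := exists_subseq_of_forall_ballsMeetClusters h hp
  refine ⟨φ, hφ, convergesWeakly_of_tendsto_apply (fun i => hC (φ i)) fun j => ?_⟩
  -- The diagonal approximation of `x i` has error at most `2⁻ⁱ`, so it has the same coordinatewise
  -- limits.
  have hdiff : Tendsto (fun k => x (φ k) j - finiteSeqVec (a (φ k) (φ k)) j) atTop (𝓝 0) := by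
    refine squeeze_zero_norm (fun k => ?_)
      ((tendsto_pow_atTop_nhds_zero_of_lt_one (show (0 : ℝ) ≤ 2⁻¹ by norm_num)
        (by norm_num)).comp hφ.tendsto_atTop)
    refine (abs_apply_le_norm (x (φ k) - finiteSeqVec (a (φ k) (φ k))) j).trans ?_
    rw [norm_sub_rev]
    exact (ha (φ k)).norm_sub_le (φ k)
  simpa using hdiff.add (hcoord j)

/-! ### Searching for a weak cluster point -/

/-- If a decidable property of finite sequences holds for the empty sequence and sequences with
the property can always be prolonged, then a search finds an infinite sequence all of whose initial
segments have the property. -/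
theorem Nat.RecursiveIn.exists_sequence {O : Set (ℕ →. ℕ)} {G : Set ℕ}
    (hG : Nat.RecursiveIn O fun n => Part.some (charFun G n))
    (h0 : Encodable.encode ([] : List ℕ) ∈ G)
    (hstep : ∀ L : List ℕ, Encodable.encode L ∈ G → ∃ c, Encodable.encode (L ++ [c]) ∈ G) :
    ∃ c : ℕ → ℕ, (Nat.RecursiveIn O fun n => Part.some (c n)) ∧
      ∀ m, Encodable.encode ((List.range m).map c) ∈ G := by
  classical
  let app : ℕ → ℕ := fun m => Encodable.encode (Denumerable.ofNat (List ℕ) m.unpair.1 ++ [m.unpair.2])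
  have happ : Computable app :=
    (Primrec.encode.comp (Primrec.list_concat.comp
      ((Primrec.ofNat _).comp (Primrec.fst.comp Primrec.unpair))
      (Primrec.snd.comp Primrec.unpair))).to_comp
  have happ_encode : ∀ (L : List ℕ) (c : ℕ),
      app (Nat.pair (Encodable.encode L) c) = Encodable.encode (L ++ [c]) := fun L c => by
    simp [app]
  -- The default `0` is never used along the constructed sequence, by `hext`.
  let next : ℕ → ℕ := fun u => if h : ∃ c, app (Nat.pair u c) ∈ G then Nat.find h else 0
  let test : ℕ → ℕ := fun m => 1 - charFun G (app m)
  have htest : ∀ m, test m = 0 ↔ app m ∈ G := fun m => by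
    by_cases h : app m ∈ G <;> simp [test, charFun, h]
  have htestR : Nat.RecursiveIn O fun m => Part.some (test m) :=
    (show Computable fun n => 1 - n from
      (Primrec.nat_sub.comp (_root_.Primrec.const 1) .id).to_comp).natRecursiveIn.comp_some
        (hG.comp_some happ.natRecursiveIn)
  let search : ℕ →. ℕ := fun u =>
    Nat.rfind fun n => (fun m => decide (m = 0)) <$> Part.some (test (Nat.pair u n))
  have hsearchR : Nat.RecursiveIn O search := htestR.rfind
  have hsearch : ∀ u, (∃ c, app (Nat.pair u c) ∈ G) → search u = Part.some (next u) := by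
    intro u h
    refine Part.eq_some_iff.2 (Nat.mem_rfind.2 ?_)
    simp only [next, dif_pos h]
    refine ⟨?_, fun {m} hm => ?_⟩
    · simpa [htest] using Nat.find_spec h
    · simpa [htest] using Nat.find_min h hm
  let initCode : ℕ → ℕ := fun m => m.rec (Encodable.encode ([] : List ℕ))
    fun _ u => app (Nat.pair u (next u))
  have hstart : ∀ m, initCode m =
      Encodable.encode ((List.range m).map fun k => next (initCode k)) := by
    intro m
    induction m with
    | zero => rfl
    | succ m ih =>
      rw [List.range_succ, List.map_append, List.map_singleton, ← happ_encode, ← ih]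
  have hgood : ∀ m, initCode m ∈ G := by
    intro m
    induction m with
    | zero => exact h0
    | succ m ih =>
      have h : ∃ c, app (Nat.pair (initCode m) c) ∈ G := by
        rw [hstart m] at ih ⊢
        obtain ⟨c, hc⟩ := hstep _ ih
        exact ⟨c, by rwa [happ_encode]⟩
      change app (Nat.pair (initCode m) (next (initCode m))) ∈ G
      simp only [next, dif_pos h]
      exact Nat.find_spec h
  have hext : ∀ m, ∃ c, app (Nat.pair (initCode m) c) ∈ G := fun m => ⟨_, hgood (m + 1)⟩
  -- The search may diverge in general, but the recursion only visits the codes `initCode m`, where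
  -- it halts.
  have hiter : Nat.RecursiveIn O fun u => search u >>= fun c => Part.some (app (Nat.pair u c)) := by
    refine (happ.natRecursiveIn.comp
      ((Computable.id.natRecursiveIn (O := O)).pair hsearchR)).of_eq fun u => ?_
    simp [Seq.seq, Part.bind_map]
  have hprec := Nat.RecursiveIn.prec (O := O)
    ((Computable.const (Encodable.encode ([] : List ℕ))).natRecursiveIn)
    (hiter.comp ((Computable.snd.comp (Computable.unpair.comp
      (Computable.snd.comp Computable.unpair))).natRecursiveIn))
  have hinitR : Nat.RecursiveIn O fun m => Part.some (initCode m) := by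
    refine (hprec.comp (((Computable.const 0).natRecursiveIn).pair_some
      Computable.id.natRecursiveIn)).of_eq fun m => ?_
    simp only [Part.bind_eq_bind, Part.bind_some, Nat.unpair_pair, id]
    induction m with
    | zero => rfl
    | succ m ih =>
      simp only [ih, Part.bind_some, hsearch _ (hext m)]
      rfl
  refine ⟨fun m => next (initCode m), ?_, fun m => hstart m ▸ hgood m⟩
  refine (hsearchR.comp hinitR).of_eq fun m => ?_
  exact (Part.bind_some _ _).trans (hsearch _ (hext m))

/-! ### Primitive recursive arithmetic on codes of rational sequences. -/

theorem primrecPred_pos_and_coprime :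
    PrimrecPred fun p : ℤ × ℕ => 0 < p.2 ∧ p.1.natAbs.Coprime p.2 := by
  open Primrec in
  -- Coprimality by a bounded search for a common divisor other than `1`. The candidate `k = 0` is
  -- harmless, as it does not divide the positive `p.2`.
  have h : PrimrecPred fun p : ℤ × ℕ => 0 < p.2 ∧
      ¬ ∃ k < p.2 + 1, k ≠ 1 ∧ p.1.natAbs % k = 0 ∧ p.2 % k = 0 := by
    refine (nat_lt.comp (const 0) snd).and (PrimrecPred.not (PrimrecRel.exists_lt_comp
      (R := fun k (p : ℤ × ℕ) => k ≠ 1 ∧ p.1.natAbs % k = 0 ∧ p.2 % k = 0) ?_ (succ.comp snd)))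
    exact (PrimrecPred.not (Primrec.eq.comp fst (const 1))).and
      ((Primrec.eq.comp (nat_mod.comp (primrec_int_natAbs.comp (fst.comp snd)) fst) (const 0)).and
        (Primrec.eq.comp (nat_mod.comp (snd.comp snd) fst) (const 0)))
  refine h.of_eq fun p => and_congr_right fun hp => ?_
  simp only [← Nat.dvd_iff_mod_eq_zero]
  constructor
  · intro h
    by_contra hc
    exact h ⟨_, Nat.lt_succ_of_le (Nat.le_of_dvd hp (Nat.gcd_dvd_right _ _)), hc,
      Nat.gcd_dvd_left _ _, Nat.gcd_dvd_right _ _⟩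
  · rintro h ⟨k, -, hk, h1, h2⟩
    exact hk (Nat.eq_one_of_dvd_coprimes h h1 h2)

/-- The finite sequence of rationals given by pairs `(numerator, denominator)`. -/
def ratSeq (l : List (ℤ × ℕ)) : List ℚ := l.map fun p => (p.1 : ℚ) / p.2

/-- `c` is the code of a finite sequence of rationals. -/
def IsSeqCode (c : ℕ) : Prop :=
  Encodable.encode (decodeSeq c) = c ∧ ∀ p ∈ decodeSeq c, 0 < p.2 ∧ p.1.natAbs.Coprime p.2

theorem primrecPred_isSeqCode : PrimrecPred IsSeqCode :=
  (Primrec.eq.comp (Primrec.encode.comp primrec_decodeSeq) Primrec.id).and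
    (primrecPred_pos_and_coprime.forall_mem_list.comp primrec_decodeSeq)

theorem isSeqCode_finiteSeqCode (r : List ℚ) : IsSeqCode (finiteSeqCode r) := by
  rw [IsSeqCode, decodeSeq_finiteSeqCode]
  refine ⟨rfl, fun p hp => ?_⟩
  obtain ⟨q, -, rfl⟩ := List.mem_map.1 hp
  exact ⟨q.den_pos, q.reduced⟩

theorem ratSeq_decodeSeq_finiteSeqCode (r : List ℚ) :
    ratSeq (decodeSeq (finiteSeqCode r)) = r := by
  rw [decodeSeq_finiteSeqCode, ratSeq, List.map_map]
  refine (List.map_congr_left fun q _ => ?_).trans r.map_id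
  exact Rat.num_div_den q

theorem IsSeqCode.finiteSeqCode_eq {c : ℕ} (h : IsSeqCode c) :
    finiteSeqCode (ratSeq (decodeSeq c)) = c := by
  conv_rhs => rw [← h.1]
  rw [finiteSeqCode, ratSeq, List.map_map]
  congr 1
  refine (List.map_congr_left fun p hp => ?_).trans (List.map_id _)
  obtain ⟨hp0, hp1⟩ := h.2 p hp
  refine Prod.ext ?_ ?_
  · exact Rat.num_div_eq_of_coprime (by exact_mod_cast hp0) hp1
  · exact_mod_cast Rat.den_div_eq_of_coprime (a := p.1) (b := p.2) (by exact_mod_cast hp0) hp1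

/-- The numerator of the absolute value of the difference of two fractions. -/
def crossDiff (u v : ℤ × ℕ) : ℕ :=
  -- Splitting the numerators into positive and negative parts makes `x - y` the cross difference
  -- using only natural numbers; the two truncated subtractions then add up to its absolute value.
  let x := u.1.toNat * v.2 + (v.1.natAbs - v.1.toNat) * u.2
  let y := (u.1.natAbs - u.1.toNat) * v.2 + v.1.toNat * u.2
  (x - y) + (y - x)

theorem primrec_crossDiff : Primrec₂ crossDiff := by
  open Primrec in
  have hp : Primrec fun z : ℤ => z.toNat := primrec_int_toNat
  have hn : Primrec fun z : ℤ => z.natAbs - z.toNat := nat_sub.comp primrec_int_natAbs hp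
  have hx : Primrec fun p : (ℤ × ℕ) × (ℤ × ℕ) =>
      p.1.1.toNat * p.2.2 + (p.2.1.natAbs - p.2.1.toNat) * p.1.2 :=
    nat_add.comp (nat_mul.comp (hp.comp (fst.comp fst)) (snd.comp snd))
      (nat_mul.comp (hn.comp (fst.comp snd)) (snd.comp fst))
  have hy : Primrec fun p : (ℤ × ℕ) × (ℤ × ℕ) =>
      (p.1.1.natAbs - p.1.1.toNat) * p.2.2 + p.2.1.toNat * p.1.2 :=
    nat_add.comp (nat_mul.comp (hn.comp (fst.comp fst)) (snd.comp snd))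
      (nat_mul.comp (hp.comp (fst.comp snd)) (snd.comp fst))
  exact nat_add.comp (nat_sub.comp hx hy) (nat_sub.comp hy hx)

theorem crossDiff_sq (u v : ℤ × ℕ) :
    (crossDiff u v : ℝ) ^ 2 = ((u.1 : ℝ) * v.2 - v.1 * u.2) ^ 2 := by
  have h : (crossDiff u v : ℤ) = |u.1 * v.2 - v.1 * u.2| := by
    have hz : ∀ z : ℤ, z = (z.toNat : ℤ) - ((z.natAbs - z.toNat : ℕ) : ℤ) := fun z => by omega
    have hsplit : u.1 * v.2 - v.1 * u.2 =
        ((u.1.toNat * v.2 + (v.1.natAbs - v.1.toNat) * u.2 : ℕ) : ℤ) -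
          (((u.1.natAbs - u.1.toNat) * v.2 + v.1.toNat * u.2 : ℕ) : ℤ) := by
      conv_lhs => rw [hz u.1, hz v.1]
      push_cast
      ring
    rw [hsplit]
    simp only [crossDiff]
    generalize u.1.toNat * v.2 + (v.1.natAbs - v.1.toNat) * u.2 = x
    generalize (u.1.natAbs - u.1.toNat) * v.2 + v.1.toNat * u.2 = y
    rcases le_total x y with hxy | hxy
    · rw [abs_of_nonpos (by omega)]
      omega
    · rw [abs_of_nonneg (by omega)]
      omega
  have habs : (crossDiff u v : ℝ) = |(u.1 : ℝ) * v.2 - v.1 * u.2| := by exact_mod_cast h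
  rw [habs, sq_abs]

/-- Numerator and denominator of the sum of the squares of the differences of the first `n`
coordinates. -/
def sqDistFrac (l k : List (ℤ × ℕ)) (n : ℕ) : ℕ × ℕ :=
  n.rec (0, 1) fun j q =>
    let u := l.getD j (0, 1)
    let v := k.getD j (0, 1)
    (q.1 * (u.2 * v.2) ^ 2 + q.2 * crossDiff u v ^ 2, q.2 * (u.2 * v.2) ^ 2)

theorem primrec_sqDistFrac :
    Primrec fun p : (List (ℤ × ℕ) × List (ℤ × ℕ)) × ℕ => sqDistFrac p.1.1 p.1.2 p.2 := by
  open Primrec in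
  have hq : Primrec fun p : (List (ℤ × ℕ) × List (ℤ × ℕ)) × ℕ × ℕ × ℕ => p.2.2 := snd.comp snd
  have hu : Primrec fun p : (List (ℤ × ℕ) × List (ℤ × ℕ)) × ℕ × ℕ × ℕ =>
      p.1.1.getD p.2.1 (0, 1) := (list_getD (0, 1)).comp (fst.comp fst) (fst.comp snd)
  have hv : Primrec fun p : (List (ℤ × ℕ) × List (ℤ × ℕ)) × ℕ × ℕ × ℕ =>
      p.1.2.getD p.2.1 (0, 1) := (list_getD (0, 1)).comp (snd.comp fst) (fst.comp snd)
  have hd := primrec_pow.comp (nat_mul.comp (snd.comp hu) (snd.comp hv)) (const 2)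
  exact nat_rec (const ((0 : ℕ), 1)) (Primrec.pair
    (nat_add.comp (nat_mul.comp (fst.comp hq) hd)
      (nat_mul.comp (snd.comp hq) (primrec_pow.comp (primrec_crossDiff.comp hu hv) (const 2))))
    (nat_mul.comp (snd.comp hq) hd)).to₂

theorem getD_ratSeq (l : List (ℤ × ℕ)) (j : ℕ) :
    (ratSeq l).getD j 0 = ((l.getD j (0, 1)).1 : ℚ) / (l.getD j (0, 1)).2 := by
  have h := List.getD_map (n := j) l ((0 : ℤ), 1) fun p : ℤ × ℕ => (p.1 : ℚ) / p.2
  simpa [ratSeq] using h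

theorem getD_den_pos {l : List (ℤ × ℕ)} (hl : ∀ p ∈ l, 0 < p.2) (j : ℕ) :
    0 < (l.getD j (0, 1)).2 := by
  rcases lt_or_ge j l.length with hj | hj
  · rw [List.getD_eq_getElem _ _ hj]
    exact hl _ (List.getElem_mem hj)
  · rw [List.getD_eq_default _ _ hj]
    exact one_pos

theorem sqDistFrac_spec {l k : List (ℤ × ℕ)} (hl : ∀ p ∈ l, 0 < p.2) (hk : ∀ p ∈ k, 0 < p.2)
    (n : ℕ) : 0 < (sqDistFrac l k n).2 ∧
      ((sqDistFrac l k n).1 : ℝ) / (sqDistFrac l k n).2 = ∑ j ∈ Finset.range n,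
        (finiteSeqVec (ratSeq l) j - finiteSeqVec (ratSeq k) j) ^ 2 := by
  induction n with
  | zero => simp [sqDistFrac]
  | succ n ih =>
    obtain ⟨hpos, hsum⟩ := ih
    have hu := getD_den_pos hl n
    have hv := getD_den_pos hk n
    have hstep : sqDistFrac l k (n + 1) =
        ((sqDistFrac l k n).1 * ((l.getD n (0, 1)).2 * (k.getD n (0, 1)).2) ^ 2 +
          (sqDistFrac l k n).2 * crossDiff (l.getD n (0, 1)) (k.getD n (0, 1)) ^ 2,
          (sqDistFrac l k n).2 * ((l.getD n (0, 1)).2 * (k.getD n (0, 1)).2) ^ 2) := rfl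
    rw [hstep, Finset.sum_range_succ, ← hsum, finiteSeqVec_apply, finiteSeqVec_apply, getD_ratSeq,
      getD_ratSeq]
    generalize l.getD n (0, 1) = u at *
    generalize k.getD n (0, 1) = v at *
    generalize sqDistFrac l k n = q at *
    refine ⟨by positivity, ?_⟩
    push_cast
    rw [crossDiff_sq]
    have h1 : (q.2 : ℝ) ≠ 0 := by exact_mod_cast hpos.ne'
    have h2 : (u.2 : ℝ) ≠ 0 := by exact_mod_cast hu.ne'
    have h3 : (v.2 : ℝ) ≠ 0 := by exact_mod_cast hv.ne'
    field_simp

/-- The first `n` coordinates of two finite sequences satisfy the `s`-th ball condition. -/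
def FracClose (l k : List (ℤ × ℕ)) (n s : ℕ) : Prop :=
  (sqDistFrac l k n).1 * (4 ^ (s + 2) * 2 ^ n) < (sqDistFrac l k n).2 * (2 ^ n + 4 ^ (s + 2))

/-- Clearing the positive denominators leaves an inequality between natural numbers. -/
theorem fracClose_iff {l k : List (ℤ × ℕ)} (hl : ∀ p ∈ l, 0 < p.2) (hk : ∀ p ∈ k, 0 < p.2)
    (n s : ℕ) : FracClose l k n s ↔ ∑ j ∈ Finset.range n,
      (finiteSeqVec (ratSeq l) j - finiteSeqVec (ratSeq k) j) ^ 2 <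
        (1 / 4 : ℝ) ^ (s + 2) + (1 / 2 : ℝ) ^ n := by
  obtain ⟨hpos, hsum⟩ := sqDistFrac_spec hl hk n
  have hpos' : (0 : ℝ) < (sqDistFrac l k n).2 := by exact_mod_cast hpos
  have h : (1 / 4 : ℝ) ^ (s + 2) + (1 / 2 : ℝ) ^ n =
      (2 ^ n + 4 ^ (s + 2)) / (4 ^ (s + 2) * 2 ^ n) := by
    rw [one_div_pow, one_div_pow]
    field_simp
  rw [← hsum, h, div_lt_div_iff₀ hpos' (by positivity), mul_comm ((2 : ℝ) ^ n + _), FracClose]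
  exact_mod_cast Iff.rfl

theorem primrecPred_fracClose : PrimrecPred fun p : (List (ℤ × ℕ) × List (ℤ × ℕ)) × ℕ × ℕ =>
    FracClose p.1.1 p.1.2 p.2.1 p.2.2 := by
  open Primrec in
  have hq := primrec_sqDistFrac.comp (Primrec.pair fst (fst.comp snd) :
    Primrec fun p : (List (ℤ × ℕ) × List (ℤ × ℕ)) × ℕ × ℕ => (p.1, p.2.1))
  have h4 : Primrec fun p : (List (ℤ × ℕ) × List (ℤ × ℕ)) × ℕ × ℕ => 4 ^ (p.2.2 + 2) :=
    primrec_pow.comp (const 4) (nat_add.comp (snd.comp snd) (const 2))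
  have h2 : Primrec fun p : (List (ℤ × ℕ) × List (ℤ × ℕ)) × ℕ × ℕ => 2 ^ p.2.1 :=
    primrec_pow.comp (const 2) (fst.comp snd)
  exact nat_lt.comp (nat_mul.comp (fst.comp hq) (nat_mul.comp h4 h2))
    (nat_mul.comp (snd.comp hq) (nat_add.comp h2 h4))

/-! ### The main theorem -/

/-- The matrix of the `Π₂` condition that the balls around the centers coded by the entries of a
list meet the weak cluster points of the sequence with the codes `B`. -/
def BallCondition (B : ℕ → ℕ) (w n i : ℕ) : Prop :=
  n < i ∧ ∀ s < (Denumerable.ofNat (List ℕ) w).length,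
    IsSeqCode ((Denumerable.ofNat (List ℕ) w).getD s 0) ∧
      FracClose (decodeSeq (B i)) (decodeSeq ((Denumerable.ofNat (List ℕ) w).getD s 0)) n s

theorem primrecPred_isSeqCode_and_fracClose : PrimrecPred fun p : (ℕ × ℕ) × ℕ × ℕ =>
    IsSeqCode p.1.2 ∧ FracClose (decodeSeq p.1.1) (decodeSeq p.1.2) p.2.1 p.2.2 := by
  open Primrec in
  have h : Primrec fun p : (ℕ × ℕ) × ℕ × ℕ => ((decodeSeq p.1.1, decodeSeq p.1.2), p.2) :=
    ((primrec_decodeSeq.comp (fst.comp fst)).pair (primrec_decodeSeq.comp (snd.comp fst))).pair snd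
  have h' := primrecPred_fracClose.comp h
  exact (primrecPred_isSeqCode.comp (snd.comp fst)).and h'

/-- `B` is only computable, so its value is first made a separate input; the condition is primitive
recursive in that input, and `B i` is substituted at the end. -/
theorem computablePred_ballCondition {B : ℕ → ℕ} (hB : Computable B) :
    ComputablePred fun p : (ℕ × ℕ) × ℕ => BallCondition B p.1.1 p.1.2 p.2 := by
  classical
  open Primrec in
  have hL : Primrec fun p : ((ℕ × ℕ) × ℕ) × ℕ => Denumerable.ofNat (List ℕ) p.1.1.1 :=
    (Primrec.ofNat _).comp (fst.comp (fst.comp fst))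
  have hc : Primrec fun p : ℕ × ((ℕ × ℕ) × ℕ) × ℕ =>
      (Denumerable.ofNat (List ℕ) p.2.1.1.1).getD p.1 0 :=
    (list_getD 0).comp (hL.comp snd) fst
  have h : PrimrecPred fun p : ((ℕ × ℕ) × ℕ) × ℕ => p.1.1.2 < p.1.2 ∧
      ∀ s < (Denumerable.ofNat (List ℕ) p.1.1.1).length,
        IsSeqCode ((Denumerable.ofNat (List ℕ) p.1.1.1).getD s 0) ∧
          FracClose (decodeSeq p.2)
            (decodeSeq ((Denumerable.ofNat (List ℕ) p.1.1.1).getD s 0)) p.1.1.2 s := by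
    refine (nat_lt.comp (snd.comp (fst.comp fst)) (snd.comp fst)).and (PrimrecRel.forall_lt_comp
      (R := fun s (p : ((ℕ × ℕ) × ℕ) × ℕ) =>
        IsSeqCode ((Denumerable.ofNat (List ℕ) p.1.1.1).getD s 0) ∧
          FracClose (decodeSeq p.2)
            (decodeSeq ((Denumerable.ofNat (List ℕ) p.1.1.1).getD s 0)) p.1.1.2 s) ?_
      (list_length.comp hL))
    have ht : Primrec fun p : ℕ × ((ℕ × ℕ) × ℕ) × ℕ =>
        ((p.2.2, (Denumerable.ofNat (List ℕ) p.2.1.1.1).getD p.1 0), (p.2.1.1.2, p.1)) :=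
      ((snd.comp snd).pair hc).pair ((snd.comp (fst.comp (fst.comp snd))).pair fst)
    have ht' := primrecPred_isSeqCode_and_fracClose.comp ht
    exact ht'
  have h' := h.decide.to_comp.comp (Computable.id.pair (hB.comp Computable.snd))
  exact ⟨_, h'⟩

/-- Validity of the codes depends on neither `n` nor `i`, so it can be read off at `n = 0` and moved
out of the quantifiers. -/
theorem forall_exists_ballCondition_iff (b : ℕ → List ℚ) (L : List ℕ) :
    (∀ n, ∃ i, BallCondition (fun i => finiteSeqCode (b i)) (Encodable.encode L) n i) ↔
      (∀ s < L.length, IsSeqCode (L.getD s 0)) ∧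
        BallsMeetClusters (fun i => finiteSeqVec (b i))
          (fun s => finiteSeqVec (ratSeq (decodeSeq (L.getD s 0)))) L.length := by
  have hden : ∀ c, IsSeqCode c → ∀ p ∈ decodeSeq c, 0 < p.2 := fun c hc p hp => (hc.2 p hp).1
  have hclose : ∀ (i n s : ℕ), IsSeqCode (L.getD s 0) →
      (FracClose (decodeSeq (finiteSeqCode (b i))) (decodeSeq (L.getD s 0)) n s ↔
        ∑ j ∈ Finset.range n, (finiteSeqVec (b i) j -
          finiteSeqVec (ratSeq (decodeSeq (L.getD s 0))) j) ^ 2 <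
            (1 / 4 : ℝ) ^ (s + 2) + (1 / 2 : ℝ) ^ n) := by
    intro i n s hs
    rw [fracClose_iff (hden _ (isSeqCode_finiteSeqCode (b i))) (hden _ hs),
      ratSeq_decodeSeq_finiteSeqCode]
  simp only [BallCondition, Denumerable.ofNat_encode]
  constructor
  · intro h
    have hcode : ∀ s < L.length, IsSeqCode (L.getD s 0) := fun s hs => by
      obtain ⟨i, -, hi⟩ := h 0
      exact (hi s hs).1
    refine ⟨hcode, fun n => ?_⟩
    obtain ⟨i, hni, hi⟩ := h n
    exact ⟨i, hni, fun s hs => (hclose i n s (hcode s hs)).1 (hi s hs).2⟩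
  · rintro ⟨hcode, h⟩ n
    obtain ⟨i, hni, hi⟩ := h n
    exact ⟨i, hni, fun s hs => ⟨hcode s hs, (hclose i n s (hcode s hs)).2 (hi s hs)⟩⟩

/-- The double jump of the empty set computes a weak cluster point of every bounded computable
sequence. -/
theorem exists_cluster_zeroDoubleJump {x : ℕ → Ell2} (hx : IsComputableSeq x) {C : ℝ}
    (hC : ∀ i, ‖x i‖ ≤ C) : ∃ p, IsWeakClusterPoint x p ∧ DegreeComputes zeroDoubleJump p := by
  obtain ⟨a, ha, hcomp⟩ := hx
  have hB : Computable fun i => finiteSeqCode (a i i) := hcomp.comp Computable.id Computable.id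
  have hG := turingReducible_doubleJump (computablePred_ballCondition hB)
  obtain ⟨c, hcR, hc⟩ := hG.exists_sequence
    ((forall_exists_ballCondition_iff (fun i => a i i) []).2
      ⟨fun s hs => absurd hs s.not_lt_zero, .zero _ _⟩) fun L hL => by
    obtain ⟨hcode, hL⟩ := (forall_exists_ballCondition_iff (fun i => a i i) L).1 hL
    obtain ⟨q, hq⟩ := hL.exists_succ (norm_finiteSeqVec_diagonal_le hC ha)
    have hlast : (L ++ [finiteSeqCode q]).getD L.length 0 = finiteSeqCode q := by simp
    have hstart : ∀ s < L.length, (L ++ [finiteSeqCode q]).getD s 0 = L.getD s 0 :=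
      fun s hs => List.getD_append _ _ _ _ hs
    refine ⟨finiteSeqCode q, (forall_exists_ballCondition_iff (fun i => a i i) _).2 ⟨?_, ?_⟩⟩
    · intro s hs
      rw [List.length_append, List.length_singleton] at hs
      rcases Nat.lt_succ_iff_lt_or_eq.1 hs with hs | rfl
      · rw [hstart s hs]; exact hcode s hs
      · rw [hlast]; exact isSeqCode_finiteSeqCode q
    · rw [List.length_append, List.length_singleton]
      refine hq _ (fun s hs => ?_) ?_
      · rw [hstart s hs]
      · rw [hlast, ratSeq_decodeSeq_finiteSeqCode]
  have hget : ∀ {m s : ℕ}, s < m → ((List.range m).map c).getD s 0 = c s := fun {m s} h => by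
    simp [List.getD, h]
  have hprop : ∀ m, (∀ s < m, IsSeqCode (c s)) ∧ BallsMeetClusters
      (fun i => finiteSeqVec (a i i)) (fun s => finiteSeqVec (ratSeq (decodeSeq (c s)))) m := by
    intro m
    obtain ⟨h1, h2⟩ := (forall_exists_ballCondition_iff (fun i => a i i) _).1 (hc m)
    rw [List.length_map, List.length_range] at h1 h2
    refine ⟨fun s hs => hget hs ▸ h1 s hs, fun n => ?_⟩
    obtain ⟨i, hni, hi⟩ := h2 n
    refine ⟨i, hni, fun s hs => ?_⟩
    have := hi s hs
    beta_reduce at this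
    rwa [hget hs] at this
  obtain ⟨p, hname, hp⟩ := exists_isName_isWeakClusterPoint hC ha fun m => (hprop m).2
  refine ⟨p, hp, _, hname, degreeOf_le_iff.2 ?_⟩
  -- The search yields codes rather than sequences. `IsSeqCode` guarantees that decoding and
  -- encoding again returns the same number.
  exact hcR.of_eq fun n => by
    rw [((hprop (n + 1)).1 n n.lt_succ_self).finiteSeqCode_eq]

theorem mainTheorem3 (d : TuringDegree) :
    zeroDoubleJump ≤ d ↔
      ∀ x : ℕ → Ell2, IsComputableSeq x → (∃ C : ℝ, ∀ i, ‖x i‖ ≤ C) →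
        ∃ p : Ell2, IsWeakClusterPoint x p ∧ DegreeComputes d p := by
  refine ⟨fun h x hx ⟨C, hC⟩ => ?_, zeroDoubleJump_le_of_forall_cluster⟩
  obtain ⟨p, hp, a, ha, had⟩ := exists_cluster_zeroDoubleJump hx hC
  exact ⟨p, hp, a, ha, had.trans h⟩
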